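/- Let $q$ be a prime power and $\mathbb F_q$ the field with $q$ elements. For $(a\mid b),(a'\mid b')\in\mathbb F_q^{2n}$ with $a,b,a',b'\in\mathbb F_q^n$, let $\langle (a\mid b),(a'\mid b')\rangle_S=\sum_{i=1}^n (a_ib_i'-b_ia_i')$ be the symplectic inner product and let $\mathrm{wt}_S(a\mid b)=|\{i:(a_i,b_i)\neq(0,0)\}|$ be the symplectic weight. For a linear code $\mathcal C\subseteq\mathbb F_q^{2n}$, let $\mathcal C^{\perp_S}=\{x\in\mathbb F_q^{2n}:\langle x,y\rangle_S=0\text{ for all }y\in\mathcal C\}$; the code $\mathcal C$ is symplectic self-orthogonal if $\mathcal C\subseteq\mathcal C^{\perp_S}$. The symplectic minimum distance of a nonzero linear code is the minimum of $\mathrm{wt}_S$ over its nonzero codewords. Theorem. Let $\delta\in(0,1-1/q^2)$. There is a constant $c_\delta>0$, depending only on $\delta$ and the (fixed) alphabet size $q$, such that for all integers $n\ge 1$, $0\le k\le n$ and $d$ with $d=\delta n$ the following holds. If $$\frac{q^{2n-k}-1}{q-1}<\frac{c_\delta\sqrt n\,q^{2n}}{\sum_{i=0}^{d-1}\binom ni(q^2-1)^i},$$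 then there is a symplectic self-orthogonal linear code $\mathcal C\subseteq\mathbb F_q^{2n}$ of dimension $k$ whose symplectic dual $\mathcal C^{\perp_S}$ has dimension $2n-k$ and symplectic minimum distance exactly $d$; that is, $\mathcal C^{\perp_S}$ is a $[2n,2n-k,d]$ symplectic self-orthogonal dual code. -/

import Mathlib

/-- The symplectic inner product `⟨(a|b), (a'|b')⟩_S = ⟨a, b'⟩ - ⟨b, a'⟩` on `F^{2n} = F^n × F^n`;
a vector `(a|b)` of length `2n` is the pair `(a, b)`. -/
def sympInner {F : Type*} [Field F] {n : ℕ} (u v : (Fin n → F) × (Fin n → F)) : F :=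
  u.1 ⬝ᵥ v.2 - u.2 ⬝ᵥ v.1

/-- The symplectic dual `C^{⊥_S}` of a linear code `C ⊆ F^{2n}`. -/
def sympDual {F : Type*} [Field F] {n : ℕ} (C : Submodule F ((Fin n → F) × (Fin n → F))) :
    Submodule F ((Fin n → F) × (Fin n → F)) where
  carrier := {x | ∀ y ∈ C, sympInner x y = 0}
  zero_mem' := by
    intro y _
    simp [sympInner]
  add_mem' := by
    intro a b ha hb y hy
    have h1 := ha y hy
    have h2 := hb y hy
    simp only [sympInner, Prod.fst_add, Prod.snd_add, add_dotProduct] at *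
    linear_combination h1 + h2
  smul_mem' := by
    intro r a ha y hy
    have h1 := ha y hy
    simp only [sympInner, Prod.smul_fst, Prod.smul_snd, smul_dotProduct, smul_eq_mul] at *
    linear_combination r * h1

/-- A linear code is symplectic self-orthogonal if `C ⊆ C^{⊥_S}`. -/
def IsSympSelfOrthogonal {F : Type*} [Field F] {n : ℕ}
    (C : Submodule F ((Fin n → F) × (Fin n → F))) : Prop :=
  C ≤ sympDual C

open Classical in
/-- The symplectic weight of `(a|b)`: the number of indices `i` with `(a_i, b_i) ≠ (0, 0)`. -/
noncomputable def sympWeight {F : Type*} [Field F] {n : ℕ} (v : (Fin n → F) × (Fin n → F)) : ℕ :=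
  (Finset.univ.filter fun i : Fin n => (v.1 i, v.2 i) ≠ (0, 0)).card

/-- The linear code `C` has symplectic minimum distance (exactly) `d`: the number `d` is the minimum
of the symplectic weights of the nonzero codewords. In particular `C` is not the zero code. -/
def HasSympMinDist {F : Type*} [Field F] {n : ℕ}
    (C : Submodule F ((Fin n → F) × (Fin n → F))) (d : ℕ) : Prop :=
  IsLeast {w : ℕ | ∃ v ∈ C, v ≠ 0 ∧ sympWeight v = w} d

/-! Put `r = n - k` and add to `F^{2n}` an orthogonal symplectic summand `F^{2r}`. Lagrangians of
the sum have dimension `M = n + r = 2n - k`. If one of them contains no nonzero vector whose first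
component has weight below `d`, the first projection is injective on it and its image contains its
own symplectic dual. That dual is a self-orthogonal code of dimension `k` whose dual distance is at
least `d` (`exists_sympSelfOrthogonal_of_lagrangian`). Transvections supported on two coordinates
then bring the distance down, one unit at a time, to exactly `d`
(`exists_hasSympMinDist_of_forall_le`).

A first-moment argument finds such a Lagrangian only while the mean number `l` of bad lines in a
random Lagrangian is below one. The factor `√n` is gained in `exists_lagrangian_disjoint`: the
number of bad lines is nearly Poisson, so it vanishes with positive probability even when `l` is a
small multiple of `√n`. Factorial moments up to order about `√n` are computed on clean sets, which
behave like independent choices. If every Lagrangian met the cone of bad vectors, a Bonferroni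
inequality of odd order `T` (`alternating_sum_cleanSets_le`) would hold on average, and the
comparison with `exp (-l)` in `sum_lt_alternating_sum` rules this out.

The errors in the moments are amplified by `q ^ (4 * T)` and `exp (T + 1)`, which is `exp (O(√n))`,
so it is enough that the ball of radius `d` is pseudorandom up to a factor `ρ ^ n`
(`exists_sympBall_rate`). For `z` of weight at least `d / 2` the ball meets its translate by `z`
rarely and has small character sums at `z`; the lighter vectors are rare and form the exceptional
set `A`. All three bounds evaluate a product generating function at the saddle point of the ball. -/

open Module

/-! ### Counting Lagrangian subspaces through an isotropic subspace. -/

open scoped Classical in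
/-- The Lagrangian subspaces (isotropic of dimension `M`) of a space of dimension `2 * M`. -/
noncomputable def lagrangians {F W : Type*} [Field F] [AddCommGroup W] [Module F W] [Fintype W]
    (ω : LinearMap.BilinForm F W) (M : ℕ) : Finset (Submodule F W) :=
  Finset.univ.filter fun L => L ≤ ω.orthogonal L ∧ finrank F L = M

/-- The number of Lagrangian subspaces of a symplectic space of dimension `2 * s` over a field
with `q` elements. -/
def numLagrangians (q s : ℕ) : ℕ := ∏ i ∈ Finset.range s, (q ^ (i + 1) + 1)

theorem numLagrangians_succ (q s : ℕ) :
    numLagrangians q (s + 1) = numLagrangians q s * (q ^ (s + 1) + 1) := by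
  simp [numLagrangians, Finset.prod_range_succ]

theorem numLagrangians_pos (q s : ℕ) : 0 < numLagrangians q s :=
  Finset.prod_pos fun _ _ => Nat.succ_pos _

section Lagrangian

variable {F W : Type*} [Field F] [AddCommGroup W] [Module F W]
  {ω : LinearMap.BilinForm F W} {M : ℕ}

theorem mem_lagrangians [Fintype W] {L : Submodule F W} :
    L ∈ lagrangians ω M ↔ L ≤ ω.orthogonal L ∧ finrank F L = M := by
  simp [lagrangians]

theorem isotropic_sup_span_singleton (hω : ω.IsAlt) {U : Submodule F W}
    (hU : U ≤ ω.orthogonal U) {v : W} (hv : v ∈ ω.orthogonal U) :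
    U ⊔ Submodule.span F {v} ≤ ω.orthogonal (U ⊔ Submodule.span F {v}) := by
  intro x hx y hy
  obtain ⟨u, hu, w, hw, rfl⟩ := Submodule.mem_sup.1 hx
  obtain ⟨u', hu', w', hw', rfl⟩ := Submodule.mem_sup.1 hy
  obtain ⟨a, rfl⟩ := Submodule.mem_span_singleton.1 hw
  obtain ⟨b, rfl⟩ := Submodule.mem_span_singleton.1 hw'
  have h1 : ω u' u = 0 := hU hu u' hu'
  have h2 : ω u' v = 0 := hv u' hu'
  have h3 : ω u v = 0 := hv u hu
  have h4 : ω v u = 0 := hω.isRefl _ _ h3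
  simp [h1, h2, h4, hω.self_eq_zero v]

theorem finrank_sup_span_singleton [FiniteDimensional F W] {U : Submodule F W} {v : W} (hv : v ∉ U) :
    finrank F (U ⊔ Submodule.span F {v} : Submodule F W) = finrank F U + 1 := by
  have hv0 : v ≠ 0 := fun h => hv (h ▸ U.zero_mem)
  have h := Submodule.finrank_sup_add_finrank_inf_eq U (Submodule.span F {v})
  have h2 : U ⊓ Submodule.span F {v} = ⊥ := by
    rw [Submodule.eq_bot_iff]
    rintro x ⟨hx, hx'⟩
    obtain ⟨a, rfl⟩ := Submodule.mem_span_singleton.1 hx'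
    by_cases ha : a = 0
    · simp [ha]
    · exact absurd ((U.smul_mem_iff ha).1 hx) hv
  rw [h2, finrank_bot, finrank_span_singleton hv0] at h
  omega

variable [Fintype F] [Fintype W]

open scoped Classical in
theorem card_filter_mem_submodule (U : Submodule F W) :
    (Finset.univ.filter fun v => v ∈ U).card = Fintype.card F ^ finrank F U := by
  rw [← Module.card_eq_pow_finrank (K := F) (V := U), Fintype.card_subtype]

open scoped Classical in
theorem card_filter_mem_sdiff {U L : Submodule F W} (h : U ≤ L) :
    ((Finset.univ.filter fun v => v ∈ L ∧ v ∉ U).card : ℝ) =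
      (Fintype.card F : ℝ) ^ finrank F L - (Fintype.card F : ℝ) ^ finrank F U := by
  have h1 : (Finset.univ.filter fun v => v ∈ L ∧ v ∉ U) =
      (Finset.univ.filter fun v => v ∈ L) \ (Finset.univ.filter fun v => v ∈ U) := by
    ext v; simp
  rw [h1, Finset.card_sdiff_of_subset, Nat.cast_sub, card_filter_mem_submodule,
    card_filter_mem_submodule]
  · push_cast; rfl
  · exact Finset.card_le_card fun v => by simpa using fun hv => h hv
  · exact fun v => by simpa using fun hv => h hv

open scoped Classical in
/-- The number of Lagrangian subspaces through an isotropic subspace. -/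
theorem card_lagrangians_ge (hω : ω.IsAlt) (hnd : ω.Nondegenerate) (hM : finrank F W = 2 * M)
    (s : ℕ) : ∀ U : Submodule F W, U ≤ ω.orthogonal U → finrank F U + s = M →
      ((lagrangians ω M).filter fun L => U ≤ L).card = numLagrangians (Fintype.card F) s := by
  induction s with
  | zero =>
    intro U hU hs
    have : ((lagrangians ω M).filter fun L => U ≤ L) = {U} := by
      ext L
      simp only [Finset.mem_filter, mem_lagrangians, Finset.mem_singleton]
      constructor
      · rintro ⟨⟨_, h2⟩, h3⟩
        exact (Submodule.eq_of_le_of_finrank_eq h3 (by omega)).symm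
      · rintro rfl
        exact ⟨⟨hU, by omega⟩, le_rfl⟩
    rw [this]; simp [numLagrangians]
  | succ s ih =>
    intro U hU hs
    set q := Fintype.card F with hq
    have hq1 : 1 < q := Fintype.one_lt_card
    -- Double count pairs `v ∈ L` with `v` in `U^⊥` outside `U`. All of `L` lies in `U^⊥`, and the
    -- Lagrangians through `U` and `v` are counted by induction.
    have key := Finset.sum_card_bipartiteAbove_eq_sum_card_bipartiteBelow
      (s := (lagrangians ω M).filter fun L => U ≤ L)
      (t := Finset.univ.filter fun v => v ∈ ω.orthogonal U ∧ v ∉ U) (fun L v => v ∈ L)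
    have hl : ∀ L ∈ (lagrangians ω M).filter fun L => U ≤ L,
        ((Finset.bipartiteAbove (fun (L : Submodule F W) v => v ∈ L)
          (Finset.univ.filter fun v => v ∈ ω.orthogonal U ∧ v ∉ U) L).card : ℝ) =
        (q : ℝ) ^ M - (q : ℝ) ^ finrank F U := by
      intro L hL
      simp only [Finset.mem_filter, mem_lagrangians] at hL
      rw [← hL.1.2, ← card_filter_mem_sdiff hL.2]
      congr 2
      ext v
      simp only [Finset.mem_bipartiteAbove, Finset.mem_filter, Finset.mem_univ, true_and]
      constructor
      · tauto
      · rintro ⟨h1, h2⟩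
        exact ⟨⟨fun u hu => hL.1.1 h1 u (hL.2 hu), h2⟩, h1⟩
    have hr : ∀ v ∈ Finset.univ.filter fun v => v ∈ ω.orthogonal U ∧ v ∉ U,
        (Finset.bipartiteBelow (fun (L : Submodule F W) v => v ∈ L)
          ((lagrangians ω M).filter fun L => U ≤ L) v).card = numLagrangians q s := by
      intro v hv
      simp only [Finset.mem_filter, Finset.mem_univ, true_and] at hv
      rw [← ih (U ⊔ Submodule.span F {v}) (isotropic_sup_span_singleton hω hU hv.1)
        (by rw [finrank_sup_span_singleton hv.2]; omega)]
      congr 1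
      ext L
      simp only [Finset.mem_bipartiteBelow, Finset.mem_filter, sup_le_iff,
        Submodule.span_singleton_le_iff_mem]
      tauto
    rw [Finset.sum_congr rfl hr, Finset.sum_const, smul_eq_mul] at key
    have key' := congrArg (Nat.cast : ℕ → ℝ) key
    rw [Nat.cast_sum, Finset.sum_congr rfl hl, Finset.sum_const, nsmul_eq_mul, Nat.cast_mul,
      card_filter_mem_sdiff hU, LinearMap.BilinForm.finrank_orthogonal hnd, hM] at key'
    have e1 : 2 * M - finrank F U = finrank F U + (s + 1) + (s + 1) := by omega
    rw [e1, ← hs, ← hq] at key'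
    rw [← hs]
    have hqr : (1 : ℝ) < q := by exact_mod_cast hq1
    -- The new factor arises as `(q ^ (2 * (s + 1)) - 1) / (q ^ (s + 1) - 1) = q ^ (s + 1) + 1`.
    have hne : (q : ℝ) ^ finrank F U * ((q : ℝ) ^ (s + 1) - 1) ≠ 0 :=
      mul_ne_zero (by positivity) (sub_ne_zero.2 (one_lt_pow₀ hqr (by omega)).ne')
    have : ((((lagrangians ω (finrank F U + (s + 1))).filter fun L => U ≤ L).card : ℕ) : ℝ) =
        (numLagrangians q (s + 1) : ℕ) := by
      apply mul_right_cancel₀ hne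
      rw [numLagrangians_succ]
      push_cast
      simp only [pow_add] at key' ⊢
      linear_combination key'
    exact_mod_cast this

end Lagrangian

/-! ### Clean sets: generic configurations of bad lines. -/

/-- `B₀` contains exactly one nonzero vector of each line contained in the cone `B`. -/
structure IsTransversal (F : Type*) {W : Type*} [Field F] [AddCommGroup W] [Module F W]
    (B B₀ : Finset W) : Prop where
  subset : B₀ ⊆ B
  zero_notMem : (0 : W) ∉ B
  smul_mem : ∀ c : F, c ≠ 0 → ∀ b ∈ B, c • b ∈ B
  exists_rep : ∀ b ∈ B, ∃ b₀ ∈ B₀, ∃ c : F, b = c • b₀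
  eq_of_eq_smul : ∀ b ∈ B₀, ∀ b' ∈ B₀, ∀ c : F, b = c • b' → b = b'

/-- A set `S ⊆ B₀` is clean if it is linearly independent and isotropic, its span meets `B` only in
the lines of the members of `S`, and its span avoids `A`. -/
structure IsClean {F W : Type*} [Field F] [AddCommGroup W] [Module F W]
    (ω : LinearMap.BilinForm F W) (A B B₀ S : Finset W) : Prop where
  subset : S ⊆ B₀
  linearIndepOn : LinearIndepOn F id (S : Set W)
  isotropic : ∀ x ∈ S, ∀ y ∈ S, ω x y = 0
  eq_smul : ∀ v ∈ Submodule.span F (S : Set W), v ∈ B → ∃ s ∈ S, ∃ c : F, v = c • s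
  notMem : ∀ v ∈ Submodule.span F (S : Set W), v ∉ A

section Clean

variable {F W : Type*} [Field F] [AddCommGroup W] [Module F W]
  {ω : LinearMap.BilinForm F W} {A B B₀ S S' : Finset W}

theorem IsTransversal.ne_zero (hB : IsTransversal F B B₀) {b : W} (hb : b ∈ B) : b ≠ 0 :=
  fun h => hB.zero_notMem (h ▸ hb)

theorem isClean_empty (hB : IsTransversal F B B₀) (hA : (0 : W) ∉ A) : IsClean ω A B B₀ ∅ where
  subset := Finset.empty_subset _
  linearIndepOn := by simp
  isotropic := by simp
  eq_smul := by
    intro v hv hvB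
    have : v = 0 := by simpa using hv
    exact absurd this (hB.ne_zero hvB)
  notMem := by
    intro v hv
    have : v = 0 := by simpa using hv
    rwa [this]

theorem IsClean.mono (hB : IsTransversal F B B₀) (hS : IsClean ω A B B₀ S) (h : S' ⊆ S) :
    IsClean ω A B B₀ S' where
  subset := h.trans hS.subset
  linearIndepOn := hS.linearIndepOn.mono (by exact_mod_cast h)
  isotropic x hx y hy := hS.isotropic x (h hx) y (h hy)
  eq_smul := by
    intro v hv hvB
    obtain ⟨s, hs, c, rfl⟩ := hS.eq_smul v (Submodule.span_mono (by exact_mod_cast h) hv) hvB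
    refine ⟨s, ?_, c, rfl⟩
    have hc : c ≠ 0 := by
      rintro rfl
      exact hB.ne_zero hvB (zero_smul _ _)
    rw [Submodule.smul_mem_iff _ hc] at hv
    -- A member of `S` outside `S'` cannot lie in the span of `S'`, by independence of `S`.
    by_contra hs'
    have hl : LinearIndepOn F id (insert s (S' : Set W)) :=
      hS.linearIndepOn.mono (Set.insert_subset (by exact_mod_cast hs) (by exact_mod_cast h))
    have := hl.notMem_span_of_insert (by exact_mod_cast hs')
    simp only [id, Set.image_id'] at this
    exact this hv
  notMem v hv := hS.notMem v (Submodule.span_mono (by exact_mod_cast h) hv)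

theorem IsClean.notMem_span (hB : IsTransversal F B B₀) (hS : IsClean ω A B B₀ S) {b : W}
    (hb : b ∈ B₀) (hbS : b ∉ S) : b ∉ Submodule.span F (S : Set W) := by
  intro h
  obtain ⟨s, hs, c, hc⟩ := hS.eq_smul b h (hB.subset hb)
  exact hbS (hB.eq_of_eq_smul b hb s (hS.subset hs) c hc ▸ hs)

theorem IsClean.span_le_orthogonal (hS : IsClean ω A B B₀ S) :
    Submodule.span F (S : Set W) ≤ ω.orthogonal (Submodule.span F (S : Set W)) := by
  intro x hx y hy
  have h1 : ∀ y ∈ S, ω y x = 0 := by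
    intro y hy
    induction hx using Submodule.span_induction with
    | mem x hx => exact hS.isotropic y hy x hx
    | zero => simp
    | add a b _ _ ha hb => simp [ha, hb]
    | smul c a _ ha => simp [ha]
  induction hy using Submodule.span_induction with
  | mem y hy => exact h1 y hy
  | zero => simp
  | add a b _ _ ha hb => simp_all
  | smul c a _ ha => simp_all

theorem IsClean.finrank_span (hS : IsClean ω A B B₀ S) :
    finrank F (Submodule.span F (S : Set W)) = S.card :=
  finrank_span_finset_eq_card hS.linearIndepOn

-- A vector of the new span outside the old one can be scaled to the form `b + u`, and both `B` and
-- `A` are cones, so only the translates of `b` need checking. This is what bounds the obstructions.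
open scoped Classical in
theorem IsClean.insert_of_forall (hω : ω.IsAlt) (hB : IsTransversal F B B₀)
    (hA : ∀ c : F, c ≠ 0 → ∀ a ∈ A, c • a ∈ A) (hS : IsClean ω A B B₀ S) {b : W} (hb : b ∈ B₀)
    (hbS : b ∉ S) (ho : ∀ s ∈ S, ω s b = 0)
    (h1 : ∀ u ∈ Submodule.span F (S : Set W), u ≠ 0 → b + u ∉ B)
    (h2 : ∀ u ∈ Submodule.span F (S : Set W), b + u ∉ A) :
    IsClean ω A B B₀ (insert b S) where
  subset := Finset.insert_subset hb hS.subset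
  linearIndepOn := by
    rw [Finset.coe_insert]
    refine hS.linearIndepOn.insert ?_
    simpa using hS.notMem_span hB hb hbS
  isotropic := by
    have ho' : ∀ s ∈ S, ω b s = 0 := fun s hs => hω.isRefl _ _ (ho s hs)
    intro x hx y hy
    rcases Finset.mem_insert.1 hx with rfl | hx' <;> rcases Finset.mem_insert.1 hy with rfl | hy'
    · exact hω.self_eq_zero _
    · exact ho' y hy'
    · exact ho x hx'
    · exact hS.isotropic x hx' y hy'
  eq_smul := by
    intro v hv hvB
    rw [Finset.coe_insert, Submodule.mem_span_insert] at hv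
    obtain ⟨c, u, hu, rfl⟩ := hv
    by_cases hc : c = 0
    · subst hc
      rw [zero_smul, zero_add] at hvB ⊢
      obtain ⟨s, hs, h⟩ := hS.eq_smul u hu hvB
      exact ⟨s, Finset.mem_insert_of_mem hs, h⟩
    · have h3 := hB.smul_mem c⁻¹ (inv_ne_zero hc) _ hvB
      rw [smul_add, inv_smul_smul₀ hc] at h3
      by_cases hu0 : u = 0
      · exact ⟨b, Finset.mem_insert_self _ _, c, by simp [hu0]⟩
      · exact absurd h3 (h1 _ (Submodule.smul_mem _ _ hu) (smul_ne_zero (inv_ne_zero hc) hu0))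
  notMem := by
    intro v hv hvA
    rw [Finset.coe_insert, Submodule.mem_span_insert] at hv
    obtain ⟨c, u, hu, rfl⟩ := hv
    by_cases hc : c = 0
    · subst hc
      rw [zero_smul, zero_add] at hvA
      exact hS.notMem u hu hvA
    · have h3 := hA c⁻¹ (inv_ne_zero hc) _ hvA
      rw [smul_add, inv_smul_smul₀ hc] at h3
      exact h2 _ (Submodule.smul_mem _ _ hu) h3

-- Add the elements of `J` to `S` one at a time and stop just before cleanness is first lost.
open scoped Classical in
theorem IsClean.exists_not_isClean_insert {J : Finset W} (hS : IsClean ω A B B₀ S)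
    (hJ : ¬ IsClean ω A B B₀ (S ∪ J)) :
    ∃ S', S ⊆ S' ∧ S' ⊆ S ∪ J ∧ IsClean ω A B B₀ S' ∧
      ∃ b ∈ J, b ∉ S' ∧ ¬ IsClean ω A B B₀ (insert b S') := by
  induction J using Finset.induction_on with
  | empty => exact absurd (by simpa using hS) hJ
  | insert a J ha ih =>
    by_cases h : IsClean ω A B B₀ (S ∪ J)
    · rw [Finset.union_insert] at hJ
      refine ⟨S ∪ J, Finset.subset_union_left, ?_, h, a, Finset.mem_insert_self _ _, ?_, hJ⟩
      · rw [Finset.union_insert]; exact Finset.subset_insert _ _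
      · intro haS
        rw [Finset.insert_eq_of_mem haS] at hJ
        exact hJ h
    · obtain ⟨S', h1, h2, h3, b, hb, h4⟩ := ih h
      refine ⟨S', h1, h2.trans ?_, h3, b, Finset.mem_insert_of_mem hb, h4⟩
      rw [Finset.union_insert]; exact Finset.subset_insert _ _

end Clean

/-! ### Truncated inclusion-exclusion over clean sets, and averages over Lagrangians. -/

open scoped Classical in
/-- The clean sets with `m` elements. -/
noncomputable def cleanSets {F W : Type*} [Field F] [AddCommGroup W] [Module F W]
    (ω : LinearMap.BilinForm F W) (A B B₀ : Finset W) (m : ℕ) : Finset (Finset W) :=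
  (B₀.powersetCard m).filter fun S => IsClean ω A B B₀ S

open scoped Classical in
/-- The vectors of `B₀` orthogonal to `S` that cannot be added to the clean set `S`. -/
noncomputable def obstructions {F W : Type*} [Field F] [AddCommGroup W] [Module F W]
    (ω : LinearMap.BilinForm F W) (A B B₀ S : Finset W) : Finset W :=
  B₀.filter fun b => b ∉ S ∧ (∀ s ∈ S, ω s b = 0) ∧ ¬ IsClean ω A B B₀ (insert b S)

section Counting

variable {F W : Type*} [Field F] [AddCommGroup W] [Module F W]
  {ω : LinearMap.BilinForm F W} {A B B₀ : Finset W} {M : ℕ}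

theorem mem_cleanSets {m : ℕ} {S : Finset W} :
    S ∈ cleanSets ω A B B₀ m ↔ IsClean ω A B B₀ S ∧ S.card = m := by
  simp only [cleanSets, Finset.mem_filter, Finset.mem_powersetCard]
  exact ⟨fun h => ⟨h.2, h.1.2⟩, fun h => ⟨⟨h.1.subset, h.2⟩, h.1⟩⟩

open scoped Classical in
theorem mem_obstructions {S : Finset W} {b : W} :
    b ∈ obstructions ω A B B₀ S ↔
      b ∈ B₀ ∧ b ∉ S ∧ (∀ s ∈ S, ω s b = 0) ∧ ¬ IsClean ω A B B₀ (insert b S) := by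
  simp only [obstructions, Finset.mem_filter]

theorem cleanSets_zero (hB : IsTransversal F B B₀) (hA : (0 : W) ∉ A) :
    cleanSets ω A B B₀ 0 = {∅} := by
  ext S
  simp only [mem_cleanSets, Finset.mem_singleton, Finset.card_eq_zero]
  exact ⟨fun h => h.2, fun h => ⟨h ▸ isClean_empty hB hA, h⟩⟩

-- Double count inclusions between clean sets of consecutive sizes; every `m`-subset of a clean set
-- is clean, which gives the factor `m + 1`.
open scoped Classical in
theorem sum_card_extensions (hB : IsTransversal F B B₀) (m : ℕ) :
    ∑ S ∈ cleanSets ω A B B₀ m,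
      (B₀.filter fun b => b ∉ S ∧ IsClean ω A B B₀ (insert b S)).card =
    (m + 1) * (cleanSets ω A B B₀ (m + 1)).card := by
  have key := Finset.sum_card_bipartiteAbove_eq_sum_card_bipartiteBelow
    (s := cleanSets ω A B B₀ m) (t := cleanSets ω A B B₀ (m + 1)) (fun S S' => S ⊆ S')
  have hr : ∀ S' ∈ cleanSets ω A B B₀ (m + 1),
      (Finset.bipartiteBelow (fun S S' => S ⊆ S') (cleanSets ω A B B₀ m) S').card = m + 1 := by
    intro S' hS'
    rw [mem_cleanSets] at hS'
    have : Finset.bipartiteBelow (fun S S' => S ⊆ S') (cleanSets ω A B B₀ m) S' =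
        S'.powersetCard m := by
      ext S
      simp only [Finset.mem_bipartiteBelow, mem_cleanSets, Finset.mem_powersetCard]
      exact ⟨fun h => ⟨h.2, h.1.2⟩, fun h => ⟨⟨hS'.1.mono hB h.1, h.2⟩, h.1⟩⟩
    rw [this, Finset.card_powersetCard, hS'.2, Nat.choose_succ_self_right]
  rw [Finset.sum_congr rfl hr, Finset.sum_const, smul_eq_mul, mul_comm] at key
  rw [← key]
  refine Finset.sum_congr rfl fun S hS => ?_
  rw [mem_cleanSets] at hS
  refine Finset.card_bij (fun b _ => insert b S) ?_ ?_ ?_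
  · intro b hb
    simp only [Finset.mem_filter] at hb
    rw [Finset.mem_bipartiteAbove, mem_cleanSets, Finset.card_insert_of_notMem hb.2.1, hS.2]
    exact ⟨⟨hb.2.2, rfl⟩, Finset.subset_insert _ _⟩
  · intro b hb b' hb' h
    simp only [Finset.mem_filter] at hb hb'
    have : b ∈ insert b' S := h ▸ Finset.mem_insert_self b S
    exact (Finset.mem_insert.1 this).resolve_right hb.2.1
  · intro S' hS'
    rw [Finset.mem_bipartiteAbove, mem_cleanSets] at hS'
    obtain ⟨⟨h1, h2⟩, h3⟩ := hS'
    obtain ⟨b, hb, rfl⟩ : ∃ b, b ∉ S ∧ insert b S = S' := by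
      have : (S' \ S).card = 1 := by
        rw [Finset.card_sdiff_of_subset h3]; omega
      obtain ⟨b, hb⟩ := Finset.card_eq_one.1 this
      refine ⟨b, ?_, ?_⟩
      · have : b ∈ S' \ S := hb ▸ Finset.mem_singleton_self b
        exact (Finset.mem_sdiff.1 this).2
      · rw [Finset.insert_eq, ← hb, Finset.sdiff_union_of_subset h3]
    exact ⟨b, by simpa [hb, h1] using h1.subset (Finset.mem_insert_self _ _), rfl⟩

-- A Bonferroni inequality with an error term. Were all small sets of bad lines in `L` clean, the
-- left side would be a truncated alternating sum of binomial coefficients, nonpositive because `T`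
-- is odd and `L` meets `B`. Otherwise each clean set in `L` is charged to a clean set in `L`
-- together with an obstruction in `L`.
open scoped Classical in
theorem alternating_sum_cleanSets_le (hB : IsTransversal F B B₀) {L : Submodule F W}
    (hL : L ≤ ω.orthogonal L) (hBL : ∃ b ∈ B, b ∈ L) {T : ℕ} (hT : Odd T) :
    ∑ m ∈ Finset.range (T + 1), (-1 : ℝ) ^ m *
      (((cleanSets ω A B B₀ m).filter fun S => ∀ s ∈ S, s ∈ L).card : ℝ) ≤
    ∑ m ∈ Finset.range (2 * T), 2 ^ m *
      ∑ S ∈ (cleanSets ω A B B₀ m).filter (fun S => ∀ s ∈ S, s ∈ L),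
        (((obstructions ω A B B₀ S).filter fun b => b ∈ L).card : ℝ) := by
  set P := B₀.filter fun b => b ∈ L with hP
  by_cases hcl : ∀ J ⊆ P, J.card ≤ T → IsClean ω A B B₀ J
  · refine le_trans (b := (0 : ℝ)) ?_ (Finset.sum_nonneg fun m _ => mul_nonneg
      (pow_nonneg zero_le_two m) (Finset.sum_nonneg fun S _ => Nat.cast_nonneg _))
    have h1 : ∀ m ∈ Finset.range (T + 1),
        (((cleanSets ω A B B₀ m).filter fun S => ∀ s ∈ S, s ∈ L).card : ℝ) =
          (P.card.choose m : ℝ) := by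
      intro m hm
      rw [← Finset.card_powersetCard]
      congr 2
      ext S
      simp only [Finset.mem_filter, mem_cleanSets, Finset.mem_powersetCard]
      constructor
      · rintro ⟨⟨h1, h2⟩, h3⟩
        exact ⟨fun s hs => Finset.mem_filter.2 ⟨h1.subset hs, h3 s hs⟩, h2⟩
      · rintro ⟨h1, h2⟩
        exact ⟨⟨hcl S h1 (by rw [h2]; simpa [Nat.lt_succ_iff] using hm), h2⟩,
          fun s hs => (Finset.mem_filter.1 (h1 hs)).2⟩
    rw [Finset.sum_congr rfl fun m hm => by rw [h1 m hm]]
    have hpos : 0 < P.card := by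
      obtain ⟨b, hb, hbL⟩ := hBL
      obtain ⟨b₀, hb₀, c, rfl⟩ := hB.exists_rep b hb
      have hc : c ≠ 0 := by
        rintro rfl
        exact hB.ne_zero hb (zero_smul _ _)
      exact Finset.card_pos.2 ⟨b₀, Finset.mem_filter.2 ⟨hb₀, (L.smul_mem_iff hc).1 hbL⟩⟩
    -- The truncated sum of a nonempty set telescopes to `(-1) ^ T * N.choose T`.
    obtain ⟨N, hN⟩ : ∃ N, P.card = N + 1 := ⟨P.card - 1, by omega⟩
    have h2 := Int.alternating_sum_range_choose_eq_choose (n := N) (m := T)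
    have h3 : ∑ m ∈ Finset.range (T + 1), (-1 : ℝ) ^ m * ((N + 1).choose m : ℝ) =
        (-1) ^ T * (N.choose T : ℝ) := by exact_mod_cast h2
    rw [hN, h3, hT.neg_one_pow]
    have : (0 : ℝ) ≤ N.choose T := by positivity
    linarith
  · push Not at hcl
    obtain ⟨J, hJP, hJT, hJ⟩ := hcl
    have hJL : ∀ b ∈ J, b ∈ L := fun b hb => (Finset.mem_filter.1 (hJP hb)).2
    set Y : ℕ → Finset (Finset W) := fun m =>
      (cleanSets ω A B B₀ m).filter fun S => ∀ s ∈ S, s ∈ L with hY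
    have hsub : (Finset.range (T + 1)).biUnion Y ⊆
        (Finset.range (2 * T)).biUnion fun m => (Y m).biUnion fun S =>
          ((obstructions ω A B B₀ S).filter fun b => b ∈ L).biUnion fun _ => S.powerset := by
      intro S hS
      simp only [hY, Finset.mem_biUnion, Finset.mem_range, Finset.mem_filter,
        mem_cleanSets] at hS
      obtain ⟨m, hm, ⟨hSc, hSm⟩, hSL⟩ := hS
      obtain ⟨S', h1, h2, h3, b, hb, hbS', h4⟩ := hSc.exists_not_isClean_insert (J := J)
        (fun h => hJ (h.mono hB Finset.subset_union_right))
      have hS'L : ∀ s ∈ S', s ∈ L := fun s hs =>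
        (Finset.mem_union.1 (h2 hs)).elim (hSL s) (hJL s)
      -- `S ∪ J` has at most `2 * T` elements and `S'` misses `b`; hence the range of the error sum.
      have hcard : S'.card < 2 * T := by
        have h5 : S'.card < (S ∪ J).card := Finset.card_lt_card
          ⟨h2, fun h => hbS' (h (Finset.mem_union_right _ hb))⟩
        have h6 := Finset.card_union_le S J
        omega
      simp only [Finset.mem_biUnion, Finset.mem_range]
      refine ⟨S'.card, hcard, S', ?_, b, ?_, Finset.mem_powerset.2 h1⟩
      · exact Finset.mem_filter.2 ⟨mem_cleanSets.2 ⟨h3, rfl⟩, hS'L⟩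
      · rw [Finset.mem_filter, mem_obstructions]
        exact ⟨⟨(Finset.mem_filter.1 (hJP hb)).1, hbS', fun s hs => hL (hJL b hb) s (hS'L s hs),
          h4⟩, hJL b hb⟩
    have h1 : ((Finset.range (T + 1)).biUnion Y).card =
        ∑ m ∈ Finset.range (T + 1), (Y m).card := by
      refine Finset.card_biUnion fun i _ j _ hij => Finset.disjoint_left.2 fun S hi hj => hij ?_
      rw [Finset.mem_filter, mem_cleanSets] at hi hj
      exact hi.1.2.symm.trans hj.1.2
    -- The charged set `S` is a subset of `S'`, so each pair of a clean `m`-set and an obstruction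
    -- is used at most `2 ^ m` times.
    have h2 : ((Finset.range (T + 1)).biUnion Y).card ≤ ∑ m ∈ Finset.range (2 * T), 2 ^ m *
        ∑ S ∈ Y m, ((obstructions ω A B B₀ S).filter fun b => b ∈ L).card := by
      refine (Finset.card_le_card hsub).trans (Finset.card_biUnion_le.trans ?_)
      refine Finset.sum_le_sum fun m _ => Finset.card_biUnion_le.trans ?_
      rw [Finset.mul_sum]
      refine Finset.sum_le_sum fun S hS => Finset.card_biUnion_le.trans ?_
      rw [Finset.mem_filter, mem_cleanSets] at hS
      rw [Finset.sum_const, Finset.card_powerset, hS.1.2, smul_eq_mul, mul_comm]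
    have h3 : ∑ m ∈ Finset.range (T + 1), (-1 : ℝ) ^ m * ((Y m).card : ℝ) ≤
        ∑ m ∈ Finset.range (T + 1), ((Y m).card : ℝ) := by
      refine Finset.sum_le_sum fun m _ => ?_
      have : (-1 : ℝ) ^ m ≤ 1 := (neg_one_pow_eq_or ℝ m).elim (fun h => h.le) fun h => by
        rw [h]; norm_num
      nlinarith [Nat.cast_nonneg (α := ℝ) (Y m).card]
    refine h3.trans ?_
    rw [h1] at h2
    exact_mod_cast h2

variable [Fintype F] [Fintype W]

-- A clean set spans an isotropic subspace of dimension `m`, so the number of Lagrangians above it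
-- does not depend on the set.
open scoped Classical in
theorem sum_card_cleanSets (hω : ω.IsAlt) (hnd : ω.Nondegenerate) (hM : finrank F W = 2 * M)
    {m : ℕ} (hm : m ≤ M) :
    ∑ L ∈ lagrangians ω M, ((cleanSets ω A B B₀ m).filter fun S => ∀ s ∈ S, s ∈ L).card =
      (cleanSets ω A B B₀ m).card * numLagrangians (Fintype.card F) (M - m) := by
  have key := Finset.sum_card_bipartiteAbove_eq_sum_card_bipartiteBelow
    (s := lagrangians ω M) (t := cleanSets ω A B B₀ m) (fun L S => ∀ s ∈ S, s ∈ L)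
  refine key.trans ?_
  rw [← smul_eq_mul, ← Finset.sum_const]
  refine Finset.sum_congr rfl fun S hS => ?_
  rw [mem_cleanSets] at hS
  rw [← card_lagrangians_ge hω hnd hM (M - m) _ hS.1.span_le_orthogonal
    (by rw [hS.1.finrank_span]; omega)]
  congr 1
  ext L
  simp [Finset.mem_bipartiteBelow, Submodule.span_le, Set.subset_def]

open scoped Classical in
theorem sum_card_obstructions (hω : ω.IsAlt) (hnd : ω.Nondegenerate) (hM : finrank F W = 2 * M)
    (hB : IsTransversal F B B₀) {m : ℕ} (hm : m < M) :
    ∑ L ∈ lagrangians ω M, ∑ S ∈ (cleanSets ω A B B₀ m).filter (fun S => ∀ s ∈ S, s ∈ L),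
        ((obstructions ω A B B₀ S).filter fun b => b ∈ L).card =
      ∑ S ∈ cleanSets ω A B B₀ m,
        (obstructions ω A B B₀ S).card * numLagrangians (Fintype.card F) (M - (m + 1)) := by
  simp_rw [Finset.sum_filter]
  rw [Finset.sum_comm]
  refine Finset.sum_congr rfl fun S hS => ?_
  rw [mem_cleanSets] at hS
  have key := Finset.sum_card_bipartiteAbove_eq_sum_card_bipartiteBelow
    (s := (lagrangians ω M).filter fun L => ∀ s ∈ S, s ∈ L) (t := obstructions ω A B B₀ S)
    (fun L b => b ∈ L)
  rw [← Finset.sum_filter]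
  refine key.trans ?_
  rw [← smul_eq_mul, ← Finset.sum_const]
  refine Finset.sum_congr rfl fun b hb => ?_
  rw [mem_obstructions] at hb
  have hbo : b ∈ ω.orthogonal (Submodule.span F (S : Set W)) := by
    intro y hy
    induction hy using Submodule.span_induction with
    | mem y hy => exact hb.2.2.1 y hy
    | zero => simp
    | add a c _ _ ha hc => simp_all
    | smul c a _ ha => simp_all
  rw [← card_lagrangians_ge hω hnd hM (M - (m + 1)) _
    (isotropic_sup_span_singleton hω hS.1.span_le_orthogonal hbo)
    (by rw [finrank_sup_span_singleton (hS.1.notMem_span hB hb.1 hb.2.1), hS.1.finrank_span]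
        omega)]
  congr 1
  ext L
  simp [Finset.mem_bipartiteBelow, Submodule.span_le, Set.subset_def, and_assoc]

end Counting

/-! ### Comparison with Poisson factorial moments. -/

/-- The recursion traps `x m` between `(1 - ε) ^ m` and `(1 + ε) ^ m` times the Poisson value;
Bernoulli's inequality and `exp` linearise these factors while `K * ε ≤ 1`. -/
theorem abs_sub_pow_div_factorial_le {x : ℕ → ℝ} {l ε : ℝ} {K : ℕ} (hl : 0 ≤ l) (hε : 0 ≤ ε)
    (hx0 : x 0 = 1) (hlow : ∀ m < K, (1 - ε) * l * x m ≤ (m + 1) * x (m + 1))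
    (hup : ∀ m < K, (m + 1) * x (m + 1) ≤ (1 + ε) * l * x m) (hK : K * ε ≤ 1) :
    ∀ m ≤ K, |x m - l ^ m / m.factorial| ≤ 2 * (K * ε) * (l ^ m / m.factorial) := by
  have hε1 : 0 < K → ε ≤ 1 := by
    intro h
    have : (1 : ℝ) ≤ K := by exact_mod_cast h
    nlinarith
  have key : ∀ m ≤ K, (1 - ε) ^ m * (l ^ m / m.factorial) ≤ x m ∧
      x m ≤ (1 + ε) ^ m * (l ^ m / m.factorial) := by
    intro m
    induction m with
    | zero => simp [hx0]
    | succ m ih =>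
      intro hm
      obtain ⟨h1, h2⟩ := ih (by omega)
      have h3 := hlow m (by omega)
      have h4 := hup m (by omega)
      have h5 := hε1 (by omega)
      have hm1 : (0 : ℝ) < m + 1 := by positivity
      have e1 : ∀ a : ℝ, a ^ (m + 1) * (l ^ (m + 1) / ((m + 1).factorial : ℝ)) =
          a * l * (a ^ m * (l ^ m / (m.factorial : ℝ))) / (m + 1) := by
        intro a
        rw [Nat.factorial_succ]
        push_cast
        field_simp
        ring
      rw [e1, e1, div_le_iff₀ hm1, le_div_iff₀ hm1]
      constructor
      · nlinarith [mul_le_mul_of_nonneg_left h1 (mul_nonneg (sub_nonneg.2 h5) hl)]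
      · nlinarith [mul_le_mul_of_nonneg_left h2 (mul_nonneg (by linarith : 0 ≤ 1 + ε) hl)]
  intro m hm
  obtain ⟨h1, h2⟩ := key m hm
  have hmK : (m : ℝ) * ε ≤ K * ε := mul_le_mul_of_nonneg_right (by exact_mod_cast hm) hε
  have ha : 0 ≤ l ^ m / (m.factorial : ℝ) := by positivity
  have hb1 : 1 - m * ε ≤ (1 - ε) ^ m := by
    rcases Nat.eq_zero_or_pos m with rfl | hm0
    · simp
    have := one_add_mul_le_pow (a := -ε) (by linarith [hε1 (by omega)]) m
    simpa [sub_eq_add_neg] using this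
  have hb2 : (1 + ε) ^ m ≤ 1 + 2 * (K * ε) := by
    calc (1 + ε) ^ m ≤ (Real.exp ε) ^ m :=
          pow_le_pow_left₀ (by linarith) (by linarith [Real.add_one_le_exp ε]) m
      _ = Real.exp (m * ε) := by rw [← Real.exp_nat_mul]
      _ ≤ 1 + 2 * (m * ε) := by
          have h0 : 0 ≤ (m : ℝ) * ε := by positivity
          have := Real.abs_exp_sub_one_le (x := m * ε) (by rw [abs_of_nonneg h0]; linarith)
          rw [abs_of_nonneg h0] at this
          linarith [le_abs_self (Real.exp (m * ε) - 1)]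
      _ ≤ _ := by linarith
  rw [abs_le]
  constructor
  · have := mul_le_mul_of_nonneg_right hb1 ha
    nlinarith
  · have := mul_le_mul_of_nonneg_right hb2 ha
    nlinarith

/-- A truncated alternating sum of approximate Poisson factorial moments is positive. -/
theorem sum_lt_alternating_sum {x : ℕ → ℝ} {l ε : ℝ} {T : ℕ} (hT : Odd T) (hl : 0 ≤ l)
    (hlT : 20 * l ≤ T + 1) (hε : 0 ≤ ε) (hεT : 16 * (T + 1) * ε * Real.exp (T + 1) ≤ 1)
    (hx0 : x 0 = 1) (hlow : ∀ m < 2 * T, (1 - ε) * l * x m ≤ (m + 1) * x (m + 1))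
    (hup : ∀ m < 2 * T, (m + 1) * x (m + 1) ≤ (1 + ε) * l * x m) :
    ∑ m ∈ Finset.range (2 * T), 2 ^ m * (ε * l * x m) <
      ∑ m ∈ Finset.range (T + 1), (-1) ^ m * x m := by
  have hT1 : (1 : ℝ) ≤ T := by exact_mod_cast hT.pos
  set N : ℝ := T + 1 with hN
  have hNe : N * ε * Real.exp N ≤ 1 / 16 := by linarith
  have hexpN : 1 ≤ Real.exp N := Real.one_le_exp (by linarith)
  have hNε : N * ε ≤ 1 / 16 := by
    have : 0 ≤ N * ε := by positivity
    nlinarith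
  have hTε : ((2 * T : ℕ) : ℝ) * ε ≤ 1 / 8 := by push_cast; nlinarith
  have hTε0 : 0 ≤ ((2 * T : ℕ) : ℝ) * ε := by positivity
  have happ := abs_sub_pow_div_factorial_le hl hε hx0 hlow hup (by linarith)
  set a : ℕ → ℝ := fun m => l ^ m / m.factorial with ha
  have ha0 : ∀ m, 0 ≤ a m := fun m => by positivity
  have hleft : ∑ m ∈ Finset.range (2 * T), 2 ^ m * (ε * l * x m) ≤
      2 * ε * l * Real.exp (2 * l) := by
    have h1 : ∀ m ∈ Finset.range (2 * T), 2 ^ m * (ε * l * x m) ≤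
        2 * ε * l * ((2 * l) ^ m / m.factorial) := by
      intro m hm
      have h2 := happ m (Finset.mem_range.1 hm).le
      have h3 : x m ≤ 2 * a m := by
        have := (abs_le.1 h2).2
        have := mul_le_mul_of_nonneg_right (by linarith : 2 * (((2 * T : ℕ) : ℝ) * ε) ≤ 1) (ha0 m)
        simp only [ha] at *
        linarith
      calc (2 : ℝ) ^ m * (ε * l * x m) ≤ 2 ^ m * (ε * l * (2 * a m)) := by gcongr
        _ = _ := by simp only [ha, mul_pow]; ring
    refine (Finset.sum_le_sum h1).trans ?_
    rw [← Finset.mul_sum]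
    gcongr
    exact Real.sum_le_exp_of_nonneg (by positivity) _
  have hmid : ∑ m ∈ Finset.range (T + 1), (-1) ^ m * a m -
      2 * (((2 * T : ℕ) : ℝ) * ε) * Real.exp l ≤ ∑ m ∈ Finset.range (T + 1), (-1) ^ m * x m := by
    have h1 : ∀ m ∈ Finset.range (T + 1),
        (-1) ^ m * a m - 2 * (((2 * T : ℕ) : ℝ) * ε) * a m ≤ (-1) ^ m * x m := by
      intro m hm
      have h2 := abs_le.1 (happ m (by have := Finset.mem_range.1 hm; omega))
      rcases neg_one_pow_eq_or ℝ m with h | h <;> rw [h] <;> simp only [ha] <;> linarith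
    refine le_trans ?_ (Finset.sum_le_sum h1)
    rw [Finset.sum_sub_distrib, ← Finset.mul_sum]
    gcongr
    exact Real.sum_le_exp_of_nonneg hl _
  have hexp : Real.exp (-l) - 2 * (l ^ (T + 1) / (T + 1).factorial) ≤
      ∑ m ∈ Finset.range (T + 1), (-1) ^ m * a m := by
    have h1 := Complex.exp_bound' (x := ((-l : ℝ) : ℂ)) (n := T + 1) (by
      rw [Complex.norm_real, norm_neg, Real.norm_of_nonneg hl, div_le_iff₀ (by positivity)]
      push_cast
      linarith)
    rw [Complex.norm_real, norm_neg, Real.norm_of_nonneg hl] at h1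
    have h2 : (Complex.exp ((-l : ℝ) : ℂ) -
        ∑ m ∈ Finset.range (T + 1), ((-l : ℝ) : ℂ) ^ m / (m.factorial : ℂ)) =
        ((Real.exp (-l) - ∑ m ∈ Finset.range (T + 1), (-l) ^ m / m.factorial : ℝ) : ℂ) := by
      push_cast; rfl
    rw [h2, Complex.norm_real, Real.norm_eq_abs] at h1
    have h3 : ∑ m ∈ Finset.range (T + 1), (-l) ^ m / (m.factorial : ℝ) =
        ∑ m ∈ Finset.range (T + 1), (-1) ^ m * a m :=
      Finset.sum_congr rfl fun m _ => by rw [neg_pow, mul_div_assoc]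
    rw [h3] at h1
    linarith [(abs_le.1 h1).2]
  -- The constant `20` in `hlT` is used here: `exp 2 / 20 ≤ 1 / 2`, and the exponent `T + 1` is at
  -- least `2`.
  have hfac : 2 * (l ^ (T + 1) / (T + 1).factorial) * Real.exp l ≤ 1 / 2 := by
    have h1 : l ^ (T + 1) / (T + 1).factorial ≤ (1 / 20) ^ (T + 1) * Real.exp N := by
      have h2 := Real.pow_div_factorial_le_exp (20 * l) (by positivity) (T + 1)
      have h3 : Real.exp (20 * l) ≤ Real.exp N := Real.exp_le_exp.2 hlT
      calc l ^ (T + 1) / (T + 1).factorial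
          = (1 / 20) ^ (T + 1) * ((20 * l) ^ (T + 1) / (T + 1).factorial) := by
            rw [mul_pow, ← mul_div_assoc, ← mul_assoc, ← mul_pow]; norm_num
        _ ≤ _ := by gcongr; linarith
    have h4 : Real.exp l ≤ Real.exp N := Real.exp_le_exp.2 (by linarith)
    have h5 : Real.exp N = Real.exp 1 ^ (T + 1) := by
      rw [← Real.exp_nat_mul]; push_cast; rw [mul_one]
    calc 2 * (l ^ (T + 1) / (T + 1).factorial) * Real.exp l
        ≤ 2 * ((1 / 20) ^ (T + 1) * Real.exp N) * Real.exp N := by gcongr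
      _ = 2 * (1 / 20 * Real.exp 1 * Real.exp 1) ^ (T + 1) := by rw [h5]; ring
      _ ≤ 2 * (1 / 2) ^ (T + 1) := by
          gcongr
          have := Real.exp_one_lt_d9
          nlinarith [Real.exp_pos 1]
      _ ≤ 2 * (1 / 2) ^ 2 := by
          gcongr 2 * ?_
          exact pow_le_pow_of_le_one (by norm_num) (by norm_num)
            (by have := hT.pos; omega)
      _ = 1 / 2 := by norm_num
  have hb1 : 2 * (((2 * T : ℕ) : ℝ) * ε) * Real.exp l * Real.exp l ≤ 1 / 4 := by
    have h1 : Real.exp l * Real.exp l ≤ Real.exp N := by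
      rw [← Real.exp_add]; exact Real.exp_le_exp.2 (by linarith)
    calc 2 * (((2 * T : ℕ) : ℝ) * ε) * Real.exp l * Real.exp l
        = 4 * T * ε * (Real.exp l * Real.exp l) := by push_cast; ring
      _ ≤ 4 * N * ε * Real.exp N := by gcongr; linarith
      _ ≤ 1 / 4 := by linarith
  have hb2 : 2 * ε * l * Real.exp (2 * l) * Real.exp l ≤ 1 / 8 := by
    have h1 : Real.exp (2 * l) * Real.exp l ≤ Real.exp N := by
      rw [← Real.exp_add]; exact Real.exp_le_exp.2 (by linarith)
    calc 2 * ε * l * Real.exp (2 * l) * Real.exp l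
        = 2 * ε * l * (Real.exp (2 * l) * Real.exp l) := by ring
      _ ≤ 2 * ε * N * Real.exp N := by gcongr; linarith
      _ ≤ 1 / 8 := by linarith
  refine hleft.trans_lt (lt_of_lt_of_le ?_ hmid)
  -- After multiplication by `exp l` the claim reads `1 / 8 < 1 - 1 / 2 - 1 / 4`.
  have hgoal : 2 * ε * l * Real.exp (2 * l) <
      Real.exp (-l) - 2 * (l ^ (T + 1) / (T + 1).factorial) -
        2 * (((2 * T : ℕ) : ℝ) * ε) * Real.exp l := by
    have hpos := Real.exp_pos l
    refine lt_of_mul_lt_mul_right ?_ hpos.le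
    rw [sub_mul, sub_mul, ← Real.exp_add, neg_add_cancel, Real.exp_zero]
    linarith
  linarith

/-! ### Extension counts of clean sets from pseudorandomness. -/

section Estimates

variable {F W : Type*} [Field F] [Fintype F] [AddCommGroup W] [Module F W] [Fintype W]
  {ω : LinearMap.BilinForm F W} {A B B₀ : Finset W} {M : ℕ} {η : ℝ}

open scoped Classical in
theorem card_mul_card_filter_apply_eq_zero (U : Submodule F W) (b : W)
    (hb : ∃ u ∈ U, ω u b ≠ 0) :
    Fintype.card F * (Finset.univ.filter fun u => u ∈ U ∧ ω u b = 0).card =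
      Fintype.card F ^ finrank F U := by
  set φ : Dual F U := (ω.flip b).comp U.subtype with hφ
  have hφ0 : φ ≠ 0 := by
    obtain ⟨u, hu, h⟩ := hb
    intro h0
    exact h (by simpa [hφ] using LinearMap.congr_fun h0 ⟨u, hu⟩)
  have h1 := Dual.finrank_ker_add_one_of_ne_zero hφ0
  have h2 := card_filter_mem_submodule ((LinearMap.ker φ).map U.subtype)
  rw [Submodule.finrank_map_subtype_eq] at h2
  rw [← h1, pow_succ, ← h2, mul_comm]
  congr 2
  ext u
  simp [hφ, and_comm]

-- Second-moment style passage from single vectors to a subspace: count pairs `(u, b)` with `ω u b =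
-- 0`. A vector `b` orthogonal to all of `U` is counted `q ^ dim U` times, any other exactly one
-- `q`-th as often, so the deviation for `U` is a sum of the deviations for its nonzero vectors.
open scoped Classical in
theorem abs_card_orthogonal_sub_le (U : Submodule F W)
    (hη : 0 ≤ η)
    (h1 : ∀ u ∈ U, u ≠ 0 →
      |(Fintype.card F : ℝ) * ((B₀.filter fun b => ω u b = 0).card : ℝ) - B₀.card| ≤
        η * B₀.card) :
    |(Fintype.card F : ℝ) ^ finrank F U * ((B₀.filter fun b => ∀ u ∈ U, ω u b = 0).card : ℝ)
      - B₀.card| ≤ (Fintype.card F : ℝ) ^ finrank F U * (η * B₀.card) := by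
  set q := Fintype.card F with hq
  set e := (B₀.filter fun b => ∀ u ∈ U, ω u b = 0).card with he
  have hq2 : (2 : ℝ) ≤ q := by exact_mod_cast (Fintype.one_lt_card : 1 < Fintype.card F)
  set Uf := Finset.univ.filter fun u => u ∈ U with hUf
  have hUcard : (Uf.card : ℝ) = (q : ℝ) ^ finrank F U := by
    rw [hUf, card_filter_mem_submodule]; push_cast; rfl
  have key := Finset.sum_card_bipartiteAbove_eq_sum_card_bipartiteBelow
    (s := Uf) (t := B₀) (fun u b => ω u b = 0)
  have key2 : ∑ u ∈ Uf, (q : ℝ) * ((B₀.filter fun b => ω u b = 0).card : ℝ) =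
      (q : ℝ) ^ finrank F U * B₀.card + e * ((q : ℝ) * q ^ finrank F U - q ^ finrank F U) := by
    have hb : ∀ b ∈ B₀, (q : ℝ) *
        ((Finset.bipartiteBelow (fun u b => ω u b = 0) Uf b).card : ℝ) =
        (q : ℝ) ^ finrank F U + if (∀ u ∈ U, ω u b = 0) then
          ((q : ℝ) * q ^ finrank F U - q ^ finrank F U) else 0 := by
      intro b _
      split_ifs with h
      · have : Finset.bipartiteBelow (fun u b => ω u b = 0) Uf b = Uf := by
          refine Finset.filter_true_of_mem fun u hu => h u (by simpa [hUf] using hu)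
        rw [this, hUcard]; ring
      · push Not at h
        have := card_mul_card_filter_apply_eq_zero U b h
        rw [add_zero, Finset.bipartiteBelow, hUf, Finset.filter_filter]
        exact_mod_cast this
    rw [← Finset.mul_sum]
    have key' := congrArg (Nat.cast : ℕ → ℝ) key
    push_cast at key'
    rw [show (∑ u ∈ Uf, ((B₀.filter fun b => ω u b = 0).card : ℝ)) = _ from key', Finset.mul_sum,
      Finset.sum_congr rfl hb, Finset.sum_add_distrib, Finset.sum_const, nsmul_eq_mul,
      ← Finset.sum_filter, Finset.sum_const, nsmul_eq_mul]
    ring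
  have h0 : (0 : W) ∈ Uf := by simp [hUf]
  rw [← Finset.add_sum_erase _ _ h0] at key2
  have h3 : (B₀.filter fun b => ω 0 b = 0) = B₀ := by simp
  rw [h3] at key2
  have hc : ((Uf.erase 0).card : ℝ) = (q : ℝ) ^ finrank F U - 1 := by
    rw [Finset.card_erase_of_mem h0, Nat.cast_sub (Finset.card_pos.2 ⟨0, h0⟩), hUcard]; simp
  have h4 : |∑ u ∈ Uf.erase 0, ((q : ℝ) * ((B₀.filter fun b => ω u b = 0).card : ℝ) - B₀.card)| ≤
      ((q : ℝ) ^ finrank F U - 1) * (η * B₀.card) := by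
    refine (Finset.abs_sum_le_sum_abs _ _).trans ?_
    rw [← hc, ← nsmul_eq_mul, ← Finset.sum_const]
    refine Finset.sum_le_sum fun u hu => ?_
    rw [Finset.mem_erase] at hu
    exact h1 u (by simpa [hUf] using hu.2) hu.1
  rw [Finset.sum_sub_distrib, Finset.sum_const, nsmul_eq_mul, hc] at h4
  have hpos : 0 ≤ η * B₀.card := by positivity
  have hq0 : (0 : ℝ) ≤ q ^ finrank F U := by positivity
  set y := (q : ℝ) ^ finrank F U * e - B₀.card with hy
  have h5 : ∑ u ∈ Uf.erase 0, (q : ℝ) * ((B₀.filter fun b => ω u b = 0).card : ℝ) -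
      ((q : ℝ) ^ finrank F U - 1) * B₀.card = (q - 1) * y := by
    rw [hy]; linear_combination key2
  rw [h5, abs_mul, abs_of_nonneg (by linarith : (0 : ℝ) ≤ q - 1)] at h4
  nlinarith [abs_nonneg y]

variable {S : Finset W} {m : ℕ}

-- An obstruction `b` has `b + u` in `B` with `u ≠ 0`, or in `A`, for some `u` in the span. There
-- are `q ^ S.card` choices of `u`, and cleanness keeps `u` out of `A`, so `h2` applies.
open scoped Classical in
theorem IsClean.card_obstructions_le (hω : ω.IsAlt) (hB : IsTransversal F B B₀)
    (hA : ∀ c : F, c ≠ 0 → ∀ a ∈ A, c • a ∈ A)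
    (h2 : ∀ u, u ≠ 0 → u ∉ A → ((B₀.filter fun b => b + u ∈ B).card : ℝ) ≤ η * B₀.card)
    (h3 : (A.card : ℝ) ≤ η * B₀.card) (hS : IsClean ω A B B₀ S) :
    ((obstructions ω A B B₀ S).card : ℝ) ≤
      (Fintype.card F : ℝ) ^ S.card * (2 * (η * B₀.card)) := by
  have hpos : 0 ≤ η * B₀.card := le_trans (Nat.cast_nonneg _) h3
  set U := Submodule.span F (S : Set W) with hU
  set Uf := Finset.univ.filter fun u => u ∈ U with hUf
  have hsub : obstructions ω A B B₀ S ⊆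
      Uf.biUnion fun u => (B₀.filter fun b => u ≠ 0 ∧ b + u ∈ B) ∪ B₀.filter fun b => b + u ∈ A := by
    intro b hb
    rw [mem_obstructions] at hb
    obtain ⟨hb, hbS, ho, hn⟩ := hb
    by_contra hcon
    simp only [Finset.mem_biUnion, Finset.mem_union, Finset.mem_filter, not_exists, not_and,
      not_or, hUf, Finset.mem_univ, true_and] at hcon
    exact hn (hS.insert_of_forall hω hB hA hb hbS ho (fun u hu hu0 => (hcon u hu).1 hb hu0)
      fun u hu => (hcon u hu).2 hb)
  have hcard : ((obstructions ω A B B₀ S).card : ℝ) ≤ ∑ u ∈ Uf, 2 * (η * (B₀.card : ℝ)) := by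
    refine le_trans (Nat.cast_le.2 ((Finset.card_le_card hsub).trans Finset.card_biUnion_le)) ?_
    rw [Nat.cast_sum]
    refine Finset.sum_le_sum fun u hu => ?_
    have hu' : u ∈ U := by simpa [hUf] using hu
    have e1 : ((B₀.filter fun b => u ≠ 0 ∧ b + u ∈ B).card : ℝ) ≤ η * B₀.card := by
      by_cases hu0 : u = 0
      · simpa [hu0] using hpos
      · simpa [hu0] using h2 u hu0 (hS.notMem u hu')
    have e2 : ((B₀.filter fun b => b + u ∈ A).card : ℝ) ≤ η * B₀.card := by
      refine le_trans (Nat.cast_le.2 ?_) h3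
      refine Finset.card_le_card_of_injOn (fun b => b + u) (fun b hb => ?_)
        (fun _ _ _ _ h => add_right_cancel h)
      exact (Finset.mem_filter.1 hb).2
    refine le_trans (Nat.cast_le.2 (Finset.card_union_le _ _)) ?_
    push_cast
    linarith
  refine hcard.trans_eq ?_
  rw [Finset.sum_const, nsmul_eq_mul, hUf, card_filter_mem_submodule, hU, hS.finrank_span]
  push_cast; rfl

-- The vectors of `B₀` orthogonal to `S` are the extensions, members of `S` and obstructions. The
-- first group is therefore the orthogonal count up to small errors; `h4` serves to absorb `S.card`.
open scoped Classical in
theorem IsClean.card_extensions_bounds (hω : ω.IsAlt) (hB : IsTransversal F B B₀)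
    (hA : ∀ c : F, c ≠ 0 → ∀ a ∈ A, c • a ∈ A)
    (h1 : ∀ u, u ≠ 0 → u ∉ A →
      |(Fintype.card F : ℝ) * ((B₀.filter fun b => ω u b = 0).card : ℝ) - B₀.card| ≤
        η * B₀.card)
    (h2 : ∀ u, u ≠ 0 → u ∉ A → ((B₀.filter fun b => b + u ∈ B).card : ℝ) ≤ η * B₀.card)
    (h3 : (A.card : ℝ) ≤ η * B₀.card) (h4 : 1 ≤ η * B₀.card) (hS : IsClean ω A B B₀ S) :
    (1 - 4 * (Fintype.card F : ℝ) ^ (2 * S.card) * η) * B₀.card ≤ (Fintype.card F : ℝ) ^ S.card *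
        ((B₀.filter fun b => b ∉ S ∧ IsClean ω A B B₀ (insert b S)).card : ℝ) ∧
      (Fintype.card F : ℝ) ^ S.card *
        ((B₀.filter fun b => b ∉ S ∧ IsClean ω A B B₀ (insert b S)).card : ℝ) ≤
      (1 + 4 * (Fintype.card F : ℝ) ^ (2 * S.card) * η) * B₀.card := by
  have hη : 0 ≤ η := by
    by_contra h
    have : η * B₀.card ≤ 0 := mul_nonpos_of_nonpos_of_nonneg (by linarith) (Nat.cast_nonneg _)
    linarith
  set U := Submodule.span F (S : Set W) with hU
  have horth := abs_card_orthogonal_sub_le (ω := ω) (B₀ := B₀) U hη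
    (fun u hu hu0 => h1 u hu0 (hS.notMem u hu))
  rw [hU, hS.finrank_span, ← hU] at horth
  have hobs := hS.card_obstructions_le hω hB hA h2 h3
  set q := Fintype.card F with hq
  have hq2 : 1 < q := Fintype.one_lt_card
  set E := B₀.filter fun b => b ∉ S ∧ IsClean ω A B B₀ (insert b S) with hE
  set O := B₀.filter fun b => ∀ u ∈ U, ω u b = 0 with hO
  have hspan : ∀ b, (∀ s ∈ S, ω s b = 0) → ∀ u ∈ U, ω u b = 0 := by
    intro b hb u hu
    induction hu using Submodule.span_induction with
    | mem y hy => exact hb y hy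
    | zero => simp
    | add a c _ _ ha hc => simp_all
    | smul c a _ ha => simp_all
  have hEO : E.card ≤ O.card := by
    refine Finset.card_le_card fun b hb => ?_
    rw [hE, Finset.mem_filter] at hb
    refine Finset.mem_filter.2 ⟨hb.1, hspan b fun s hs => ?_⟩
    exact hb.2.2.isotropic s (Finset.mem_insert_of_mem hs) b (Finset.mem_insert_self _ _)
  have hOE : O.card ≤ E.card + S.card + (obstructions ω A B B₀ S).card := by
    refine le_trans (Finset.card_le_card (t := E ∪ S ∪ obstructions ω A B B₀ S) fun b hb => ?_)
      ((Finset.card_union_le _ _).trans (Nat.add_le_add_right (Finset.card_union_le _ _) _))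
    rw [hO, Finset.mem_filter] at hb
    by_cases hbS : b ∈ S
    · simp [hbS]
    by_cases hc : IsClean ω A B B₀ (insert b S)
    · simp [hE, hb.1, hbS, hc]
    · rw [Finset.mem_union, mem_obstructions]
      exact Or.inr ⟨hb.1, hbS, fun s hs => hb.2 s (Submodule.subset_span hs), hc⟩
  have hScard : (S.card : ℝ) ≤ (q : ℝ) ^ S.card * (η * B₀.card) := by
    have h5 : (S.card : ℝ) ≤ (q : ℝ) ^ S.card := by exact_mod_cast (Nat.lt_pow_self hq2).le
    nlinarith
  have hEO' : (E.card : ℝ) ≤ O.card := by exact_mod_cast hEO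
  have hOE' : (O.card : ℝ) ≤ E.card + S.card + (obstructions ω A B B₀ S).card := by
    exact_mod_cast hOE
  set p := (q : ℝ) ^ S.card with hp
  have hp1 : 1 ≤ p := one_le_pow₀ (by exact_mod_cast hq2.le)
  have hpp : (q : ℝ) ^ (2 * S.card) = p * p := by rw [hp, ← pow_add, two_mul]
  rw [hpp]
  obtain ⟨o1, o2⟩ := abs_le.1 horth
  set β := (B₀.card : ℝ)
  have hpq : p * (η * β) ≤ p * p * (η * β) := by
    have : 0 ≤ (p - 1) * (p * (η * β)) :=
      mul_nonneg (by linarith) (mul_nonneg (by linarith) (by linarith))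
    nlinarith
  -- The lower bound loses `1` for orthogonality, `1` for `S` and `2` for obstructions, each in
  -- units of at most `p * p * η * β`; this is the constant `4`.
  constructor
  · have := mul_le_mul_of_nonneg_left hOE' (by linarith : 0 ≤ p)
    have := mul_le_mul_of_nonneg_left (add_le_add hScard hobs) (by linarith : 0 ≤ p)
    nlinarith
  · have := mul_le_mul_of_nonneg_left hEO' (by linarith : 0 ≤ p)
    nlinarith

end Estimates

/-! ### A Lagrangian avoiding a pseudorandom cone. -/

section Avoiding

variable {F W : Type*} [Field F] [Fintype F] [AddCommGroup W] [Module F W] [Fintype W]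

open scoped Classical in
set_option maxHeartbeats 1000000 in
/-- A symplectic space has a Lagrangian subspace avoiding a pseudorandom cone `B`. -/
theorem exists_lagrangian_disjoint {ω : LinearMap.BilinForm F W} {A B B₀ : Finset W} {M : ℕ}
    {η : ℝ} (hω : ω.IsAlt) (hnd : ω.Nondegenerate)
    (hM : finrank F W = 2 * M) (hB : IsTransversal F B B₀) (hA0 : (0 : W) ∉ A)
    (hA : ∀ c : F, c ≠ 0 → ∀ a ∈ A, c • a ∈ A)
    (h1 : ∀ u, u ≠ 0 → u ∉ A →
      |(Fintype.card F : ℝ) * ((B₀.filter fun b => ω u b = 0).card : ℝ) - B₀.card| ≤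
        η * B₀.card)
    (h2 : ∀ u, u ≠ 0 → u ∉ A → ((B₀.filter fun b => b + u ∈ B).card : ℝ) ≤ η * B₀.card)
    (h3 : (A.card : ℝ) ≤ η * B₀.card) (h4 : 1 ≤ η * B₀.card) {T : ℕ} (hT : Odd T)
    (hTM : 2 * T ≤ M) (hl : 20 * (B₀.card : ℝ) ≤ (T + 1) * (Fintype.card F : ℝ) ^ M)
    (hε : 16 * (T + 1) * (4 * (Fintype.card F : ℝ) ^ (4 * T) * η +
      (Fintype.card F : ℝ) ^ (2 * T) / (Fintype.card F : ℝ) ^ M) * Real.exp (T + 1) ≤ 1) :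
    ∃ L : Submodule F W, L ≤ ω.orthogonal L ∧ finrank F L = M ∧ ∀ b ∈ B, b ∉ L := by
  have hη : 0 ≤ η := by
    by_contra h
    have : η * B₀.card ≤ 0 := mul_nonpos_of_nonpos_of_nonneg (by linarith) (Nat.cast_nonneg _)
    linarith
  set q := Fintype.card F with hq
  have hq1 : (1 : ℝ) < q := by exact_mod_cast (Fintype.one_lt_card : 1 < Fintype.card F)
  have hq0 : (0 : ℝ) < q := by linarith
  set β := (B₀.card : ℝ) with hβ
  have hβ0 : 0 ≤ β := Nat.cast_nonneg _
  set ε := 4 * (q : ℝ) ^ (4 * T) * η + (q : ℝ) ^ (2 * T) / (q : ℝ) ^ M with hεdef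
  set G : ℕ → ℝ := fun s => (numLagrangians q s : ℝ) with hG
  have hGpos : ∀ s, 0 < G s := fun s => Nat.cast_pos.2 (numLagrangians_pos q s)
  -- The expected number of clean `m`-sets inside a uniformly random Lagrangian; it satisfies an
  -- approximate Poisson recursion with parameter `β / q ^ M`.
  set x : ℕ → ℝ := fun m => ((cleanSets ω A B B₀ m).card : ℝ) * G (M - m) / G M with hx
  have hx0 : ∀ m, 0 ≤ x m := fun m => by have := hGpos (M - m); have := hGpos M; positivity
  -- The excess of `q ^ M + q ^ m` over `q ^ M` is what the second summand of `ε` pays for.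
  have hGs : ∀ m < 2 * T, G (M - m) * (q : ℝ) ^ m = G (M - (m + 1)) * ((q : ℝ) ^ M + (q : ℝ) ^ m) := by
    intro m hm
    have e1 : M - m = (M - (m + 1)) + 1 := by omega
    have e2 : M = (M - (m + 1) + 1) + m := by omega
    simp only [hG]
    rw [e1, numLagrangians_succ]
    conv_rhs => rw [e2]
    have e3 : M - (m + 1) + 1 + m - (m + 1) = M - (m + 1) := by omega
    rw [e3, pow_add _ _ m]
    push_cast
    ring
  have hεm : ∀ m < 2 * T, 4 * (q : ℝ) ^ (2 * m) * η ≤ 4 * (q : ℝ) ^ (4 * T) * η := by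
    intro m hm
    have := pow_le_pow_right₀ hq1.le (show 2 * m ≤ 4 * T by omega)
    gcongr
  have hb2 : ∀ m < 2 * T, (q : ℝ) ^ m / (q : ℝ) ^ M ≤ (q : ℝ) ^ (2 * T) / (q : ℝ) ^ M := by
    intro m hm
    gcongr
    exact hq1.le
  have hsum : ∀ m < 2 * T, (m + 1) * x (m + 1) * ((q : ℝ) ^ M + (q : ℝ) ^ m) =
      (∑ S ∈ cleanSets ω A B B₀ m, (q : ℝ) ^ m *
        ((B₀.filter fun b => b ∉ S ∧ IsClean ω A B B₀ (insert b S)).card : ℝ)) *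
          (G (M - m) / G M) := by
    intro m hm
    have e1 := congrArg (Nat.cast : ℕ → ℝ) (sum_card_extensions (ω := ω) (A := A) hB m)
    push_cast at e1
    rw [← Finset.mul_sum, e1]
    simp only [hx]
    have := (hGpos M).ne'
    field_simp
    linear_combination -((cleanSets ω A B B₀ (m + 1)).card : ℝ) * hGs m hm
  have hlow : ∀ m < 2 * T, (1 - ε) * (β / (q : ℝ) ^ M) * x m ≤ (m + 1) * x (m + 1) := by
    intro m hm
    have hpos : 0 < (q : ℝ) ^ M + (q : ℝ) ^ m := by positivity
    rw [← mul_le_mul_iff_left₀ hpos, hsum m hm]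
    have e1 : (∑ S ∈ cleanSets ω A B B₀ m, (1 - 4 * (q : ℝ) ^ (4 * T) * η) * β) ≤
        ∑ S ∈ cleanSets ω A B B₀ m, (q : ℝ) ^ m *
        ((B₀.filter fun b => b ∉ S ∧ IsClean ω A B B₀ (insert b S)).card : ℝ) := by
      refine Finset.sum_le_sum fun S hS => ?_
      rw [mem_cleanSets] at hS
      have := (hS.1.card_extensions_bounds hω hB hA h1 h2 h3 h4).1
      rw [hS.2] at this
      refine le_trans (mul_le_mul_of_nonneg_right ?_ hβ0) this
      linarith [hεm m hm]
    rw [Finset.sum_const, nsmul_eq_mul] at e1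
    have e2 : 0 ≤ G (M - m) / G M := (div_pos (hGpos _) (hGpos _)).le
    refine le_trans ?_ (mul_le_mul_of_nonneg_right e1 e2)
    have e3 : (1 - ε) * (β / (q : ℝ) ^ M) * ((q : ℝ) ^ M + (q : ℝ) ^ m) ≤
        (1 - 4 * (q : ℝ) ^ (4 * T) * η) * β := by
      have hqM : (0 : ℝ) < (q : ℝ) ^ M := by positivity
      have e4 : (1 - ε) * (β / (q : ℝ) ^ M) * ((q : ℝ) ^ M + (q : ℝ) ^ m) =
          (1 - ε) * (1 + (q : ℝ) ^ m / (q : ℝ) ^ M) * β := by field_simp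
      rw [e4]
      refine mul_le_mul_of_nonneg_right ?_ hβ0
      have h5 := hb2 m hm
      have h6 : 0 ≤ (q : ℝ) ^ m / (q : ℝ) ^ M := by positivity
      have h7 : 0 ≤ 4 * (q : ℝ) ^ (4 * T) * η := by positivity
      have h8 : 0 ≤ ε := by positivity
      nlinarith
    calc (1 - ε) * (β / (q : ℝ) ^ M) * x m * ((q : ℝ) ^ M + (q : ℝ) ^ m)
        = ((1 - ε) * (β / (q : ℝ) ^ M) * ((q : ℝ) ^ M + (q : ℝ) ^ m)) * x m := by ring
      _ ≤ ((1 - 4 * (q : ℝ) ^ (4 * T) * η) * β) * x m :=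
          mul_le_mul_of_nonneg_right e3 (hx0 m)
      _ = _ := by simp only [hx]; ring
  have hup : ∀ m < 2 * T, (m + 1) * x (m + 1) ≤ (1 + ε) * (β / (q : ℝ) ^ M) * x m := by
    intro m hm
    have hpos : 0 < (q : ℝ) ^ M + (q : ℝ) ^ m := by positivity
    rw [← mul_le_mul_iff_left₀ hpos, hsum m hm]
    have h8 : 0 ≤ (q : ℝ) ^ (2 * T) / (q : ℝ) ^ M := by positivity
    have e1 : ∑ S ∈ cleanSets ω A B B₀ m, (q : ℝ) ^ m *
        ((B₀.filter fun b => b ∉ S ∧ IsClean ω A B B₀ (insert b S)).card : ℝ) ≤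
        (∑ S ∈ cleanSets ω A B B₀ m, (1 + ε) * β) := by
      refine Finset.sum_le_sum fun S hS => ?_
      rw [mem_cleanSets] at hS
      have := (hS.1.card_extensions_bounds hω hB hA h1 h2 h3 h4).2
      rw [hS.2] at this
      refine le_trans this (mul_le_mul_of_nonneg_right ?_ hβ0)
      linarith [hεm m hm]
    rw [Finset.sum_const, nsmul_eq_mul] at e1
    have e2 : 0 ≤ G (M - m) / G M := (div_pos (hGpos _) (hGpos _)).le
    refine le_trans (mul_le_mul_of_nonneg_right e1 e2) ?_
    have hε0 : 0 ≤ ε := by positivity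
    have hqM : (0 : ℝ) < (q : ℝ) ^ M := by positivity
    calc ((cleanSets ω A B B₀ m).card : ℝ) * ((1 + ε) * β) * (G (M - m) / G M)
        = (1 + ε) * (β / (q : ℝ) ^ M) * x m * (q : ℝ) ^ M := by simp only [hx]; field_simp
      _ ≤ _ := by
          have := hx0 m
          gcongr
          linarith [pow_pos hq0 m]
  have hobs : ∀ m < 2 * T, (∑ L ∈ lagrangians ω M,
      ∑ S ∈ (cleanSets ω A B B₀ m).filter (fun S => ∀ s ∈ S, s ∈ L),
        (((obstructions ω A B B₀ S).filter fun b => b ∈ L).card : ℝ)) ≤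
      ε * (β / (q : ℝ) ^ M) * x m * G M := by
    intro m hm
    have e1 := congrArg (Nat.cast : ℕ → ℝ)
      (sum_card_obstructions (A := A) hω hnd hM hB (show m < M by omega))
    push_cast at e1
    rw [e1]
    have e2 : (∑ S ∈ cleanSets ω A B B₀ m, ((obstructions ω A B B₀ S).card : ℝ) *
        (numLagrangians (Fintype.card F) (M - (m + 1)) : ℝ)) ≤
        ∑ S ∈ cleanSets ω A B B₀ m, ((q : ℝ) ^ m * (2 * (η * β))) * G (M - (m + 1)) := by
      refine Finset.sum_le_sum fun S hS => ?_
      rw [mem_cleanSets] at hS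
      have := hS.1.card_obstructions_le hω hB hA h2 h3
      rw [hS.2] at this
      exact mul_le_mul_of_nonneg_right this (hGpos _).le
    refine e2.trans ?_
    rw [Finset.sum_const, nsmul_eq_mul]
    have hqM : (0 : ℝ) < (q : ℝ) ^ M := by positivity
    have e3 : G (M - (m + 1)) ≤ G (M - m) * (q : ℝ) ^ m / (q : ℝ) ^ M := by
      rw [le_div_iff₀ hqM, hGs m hm]
      have := hGpos (M - (m + 1))
      gcongr
      linarith [pow_pos hq0 m]
    have hGM := hGpos M
    have hGm := hGpos (M - m)
    calc ((cleanSets ω A B B₀ m).card : ℝ) * ((q : ℝ) ^ m * (2 * (η * β)) * G (M - (m + 1)))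
        ≤ ((cleanSets ω A B B₀ m).card : ℝ) *
          ((q : ℝ) ^ m * (2 * (η * β)) * (G (M - m) * (q : ℝ) ^ m / (q : ℝ) ^ M)) := by gcongr
      _ = (2 * (q : ℝ) ^ (2 * m) * η) * (β / (q : ℝ) ^ M) * x m * G M := by
          simp only [hx]; rw [two_mul m, pow_add]; field_simp
      _ ≤ _ := by
          have := hx0 m
          have h8 : 0 ≤ (q : ℝ) ^ (2 * T) / (q : ℝ) ^ M := by positivity
          have h9 : 0 ≤ 2 * (q : ℝ) ^ (2 * m) * η := by positivity
          gcongr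
          linarith [hεm m hm]
  -- If every Lagrangian meets `B`, the Bonferroni inequality holds for each; summing over all of
  -- them and dividing by `G M` contradicts `sum_lt_alternating_sum`.
  by_contra hcon
  push Not at hcon
  have hε0 : 0 ≤ ε := by positivity
  have hx00 : x 0 = 1 := by
    simp only [hx]
    rw [cleanSets_zero hB hA0, Finset.card_singleton, Nat.sub_zero, Nat.cast_one, one_mul,
      div_self (hGpos M).ne']
  have hmain := sum_lt_alternating_sum (l := β / (q : ℝ) ^ M) hT (by positivity) (by
    rw [← mul_div_assoc, div_le_iff₀ (by positivity)]; exact hl) hε0 hε hx00 hlow hup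
  have hpt : ∀ L ∈ lagrangians ω M, _ := fun L hL =>
    alternating_sum_cleanSets_le (A := A) hB (mem_lagrangians.1 hL).1
      (hcon L (mem_lagrangians.1 hL).1 (mem_lagrangians.1 hL).2) hT
  have hs := Finset.sum_le_sum hpt
  rw [Finset.sum_comm, Finset.sum_comm (s := lagrangians ω M)] at hs
  simp_rw [← Finset.mul_sum] at hs
  have el : ∀ m ∈ Finset.range (T + 1), (-1 : ℝ) ^ m * ∑ L ∈ lagrangians ω M,
      (((cleanSets ω A B B₀ m).filter fun S => ∀ s ∈ S, s ∈ L).card : ℝ) =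
      (-1) ^ m * x m * G M := by
    intro m hm
    have e1 := congrArg (Nat.cast : ℕ → ℝ) (sum_card_cleanSets (A := A) (B := B) (B₀ := B₀) hω
      hnd hM (show m ≤ M by have := Finset.mem_range.1 hm; have := hT.pos; omega))
    push_cast at e1
    rw [e1]
    have := (hGpos M).ne'
    rw [mul_assoc, show x m * G M = ((cleanSets ω A B B₀ m).card : ℝ) * G (M - m) from
      div_mul_cancel₀ _ this]
  have er : ∑ m ∈ Finset.range (2 * T), 2 ^ m * (∑ L ∈ lagrangians ω M,
      ∑ S ∈ (cleanSets ω A B B₀ m).filter (fun S => ∀ s ∈ S, s ∈ L),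
        (((obstructions ω A B B₀ S).filter fun b => b ∈ L).card : ℝ)) ≤
      (∑ m ∈ Finset.range (2 * T), 2 ^ m * (ε * (β / (q : ℝ) ^ M) * x m)) * G M := by
    rw [Finset.sum_mul]
    refine Finset.sum_le_sum fun m hm => ?_
    rw [mul_assoc]
    exact mul_le_mul_of_nonneg_left (hobs m (Finset.mem_range.1 hm)) (by positivity)
  have hfinal : (∑ m ∈ Finset.range (T + 1), (-1) ^ m * x m) * G M ≤
      (∑ m ∈ Finset.range (2 * T), 2 ^ m * (ε * (β / (q : ℝ) ^ M) * x m)) * G M := by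
    refine le_trans (le_of_eq ?_) (hs.trans (le_trans (le_of_eq ?_) er))
    · rw [Finset.sum_mul]
      refine Finset.sum_congr rfl fun m hm => (el m hm).symm.trans ?_
      congr!
    · congr!
  have := le_of_mul_le_mul_right hfinal (hGpos M)
  linarith

end Avoiding

/-! ### Symplectic balls and product generating functions. -/

theorem sum_prod_coord {α R : Type*} [Fintype α] [CommSemiring R] {n : ℕ}
    (g : Fin n → α × α → R) :
    ∑ v : (Fin n → α) × (Fin n → α), ∏ i, g i (v.1 i, v.2 i) = ∏ i, ∑ p, g i p := by
  classical
  rw [Finset.prod_univ_sum, Fintype.piFinset_univ]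
  exact (Equiv.sum_comp (Equiv.arrowProdEquivProdArrow (Fin n) (fun _ => α) (fun _ => α))
    (fun v => ∏ i, g i (v.1 i, v.2 i))).symm

theorem AddChar.map_finset_sum {G R ι : Type*} [AddCommMonoid G] [CommMonoid R] (ψ : AddChar G R)
    (s : Finset ι) (f : ι → G) : ψ (∑ i ∈ s, f i) = ∏ i ∈ s, ψ (f i) := by
  classical
  induction s using Finset.induction_on with
  | empty => simp
  | insert a s ha ih =>
    rw [Finset.sum_insert ha, Finset.prod_insert ha, AddChar.map_add_eq_mul, ih]

section Ball

variable {F : Type*} [Field F] {n : ℕ}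

open Classical in
/-- The set of the indices `i` with `(a_i, b_i) ≠ (0, 0)`. -/
noncomputable def sympSupport {F : Type*} [Field F] {n : ℕ}
    (v : (Fin n → F) × (Fin n → F)) : Finset (Fin n) :=
  Finset.univ.filter fun i => (v.1 i, v.2 i) ≠ (0, 0)

theorem mem_sympSupport {v : (Fin n → F) × (Fin n → F)} {i : Fin n} :
    i ∈ sympSupport v ↔ (v.1 i, v.2 i) ≠ 0 := by
  simp [sympSupport]

theorem card_sympSupport (v : (Fin n → F) × (Fin n → F)) :
    (sympSupport v).card = sympWeight v := rfl

theorem sympWeight_smul {c : F} (hc : c ≠ 0) (v : (Fin n → F) × (Fin n → F)) :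
    sympWeight (c • v) = sympWeight v := by
  rw [← card_sympSupport, ← card_sympSupport]
  congr 1
  ext i
  simp [mem_sympSupport, hc]

open scoped Classical in
theorem pow_sympWeight {R : Type*} [CommSemiring R] (x : R) (v : (Fin n → F) × (Fin n → F)) :
    x ^ sympWeight v = ∏ i, if (v.1 i, v.2 i) = 0 then 1 else x := by
  rw [Finset.prod_ite, Finset.prod_const_one, one_mul, Finset.prod_const, ← card_sympSupport]
  congr 2

open scoped Classical in
theorem prod_ite_eq_zero_pow {R : Type*} [CommSemiring R] (x y : R)
    (v : (Fin n → F) × (Fin n → F)) :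
    (∏ i, if (v.1 i, v.2 i) = 0 then x else y) = x ^ (n - sympWeight v) * y ^ sympWeight v := by
  have h : Finset.univ.filter (fun i => ¬ (v.1 i, v.2 i) = 0) = sympSupport v := by
    ext i; simp [mem_sympSupport]
  rw [Finset.prod_ite, Finset.prod_const, Finset.prod_const, h, card_sympSupport]
  have h2 := Finset.card_filter_add_card_filter_not (s := (Finset.univ : Finset (Fin n)))
    (fun i => (v.1 i, v.2 i) = 0)
  rw [h, card_sympSupport, Finset.card_univ, Fintype.card_fin] at h2
  congr 2
  omega

theorem sympWeight_le (v : (Fin n → F) × (Fin n → F)) : sympWeight v ≤ n := by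
  rw [← card_sympSupport]
  exact (Finset.card_le_univ _).trans_eq (Fintype.card_fin n)

variable [Fintype F]

open scoped Classical in
theorem sum_ite_eq_zero {R : Type*} [CommRing R] (a b : R) :
    (∑ p : F × F, if p = 0 then a else b) = a + ((Fintype.card F : R) ^ 2 - 1) * b := by
  have h1 : ∀ p : F × F, (if p = 0 then a else b) = b + if p = 0 then a - b else 0 := by
    intro p; split_ifs <;> ring
  simp_rw [h1]
  rw [Finset.sum_add_distrib, Finset.sum_const, Finset.sum_ite_eq' Finset.univ (0 : F × F)]
  simp only [Finset.card_univ, Fintype.card_prod, Finset.mem_univ, if_true, nsmul_eq_mul]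
  push_cast
  ring

open scoped Classical in
theorem sum_addChar_symp {ψ : AddChar F ℂ} (hψ : ψ ≠ 1) (w : F × F) :
    (∑ p : F × F, if p = 0 then 0 else ψ (p.1 * w.2 - p.2 * w.1)) =
      if w = 0 then (Fintype.card F : ℂ) ^ 2 - 1 else -1 := by
  have hp := AddChar.IsPrimitive.of_ne_one hψ
  have h1 : ∀ p : F × F, (if p = 0 then 0 else ψ (p.1 * w.2 - p.2 * w.1)) =
      ψ (p.1 * w.2) * ψ (p.2 * (-w.1)) - if p = 0 then 1 else 0 := by
    intro p
    rw [← AddChar.map_add_eq_mul]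
    split_ifs with h
    · simp [h]
    · rw [sub_zero]; congr 1; ring
  simp_rw [h1]
  rw [Finset.sum_sub_distrib, Finset.sum_ite_eq' Finset.univ (0 : F × F), Fintype.sum_prod_type]
  simp_rw [← Finset.mul_sum]
  rw [← Finset.sum_mul, AddChar.sum_mulShift _ hp, AddChar.sum_mulShift _ hp]
  obtain ⟨a, b⟩ := w
  by_cases ha : a = 0 <;> by_cases hb : b = 0 <;> simp [ha, hb, sq]

open scoped Classical in
theorem sum_sympSupport_eq {R : Type*} [CommSemiring R] (T : Finset (Fin n))
    (g : Fin n → F × F → R) :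
    ∑ v ∈ Finset.univ.filter (fun v : (Fin n → F) × (Fin n → F) => sympSupport v = T),
      ∏ i, g i (v.1 i, v.2 i) =
    ∏ i, if i ∈ T then ∑ p, (if p = 0 then 0 else g i p) else g i 0 := by
  have h1 : ∀ v : (Fin n → F) × (Fin n → F),
      (if sympSupport v = T then ∏ i, g i (v.1 i, v.2 i) else 0) =
        ∏ i, (if (i ∈ T ↔ (v.1 i, v.2 i) ≠ 0) then g i (v.1 i, v.2 i) else 0) := by
    intro v
    split_ifs with h
    · subst h
      exact Finset.prod_congr rfl fun i _ => by rw [if_pos mem_sympSupport]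
    · have : ∃ i, ¬ (i ∈ T ↔ (v.1 i, v.2 i) ≠ 0) := by
        by_contra hcon
        push Not at hcon
        exact h (Finset.ext fun i => mem_sympSupport.trans (hcon i).symm)
      obtain ⟨i, hi⟩ := this
      exact (Finset.prod_eq_zero (Finset.mem_univ i) (if_neg hi)).symm
  rw [Finset.sum_filter, Finset.sum_congr rfl fun v _ => h1 v,
    sum_prod_coord (fun i p => if (i ∈ T ↔ p ≠ 0) then g i p else 0)]
  refine Finset.prod_congr rfl fun i _ => ?_
  split_ifs with h
  · refine Finset.sum_congr rfl fun p _ => ?_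
    by_cases hp : p = 0 <;> simp [h, hp]
  · simp [h]

open scoped Classical in
/-- The vectors of symplectic weight less than `d`. -/
noncomputable def sympBall (F : Type*) [Field F] [Fintype F] (n d : ℕ) :
    Finset ((Fin n → F) × (Fin n → F)) :=
  Finset.univ.filter fun v => sympWeight v < d

theorem mem_sympBall {d : ℕ} {v : (Fin n → F) × (Fin n → F)} :
    v ∈ sympBall F n d ↔ sympWeight v < d := by
  simp [sympBall]

open scoped Classical in
theorem sum_sympBall {R : Type*} [CommSemiring R] (d : ℕ) (g : Fin n → F × F → R) :
    ∑ v ∈ sympBall F n d, ∏ i, g i (v.1 i, v.2 i) =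
      ∑ T ∈ Finset.univ.filter (fun T : Finset (Fin n) => T.card < d),
        ∏ i, if i ∈ T then ∑ p, (if p = 0 then 0 else g i p) else g i 0 := by
  rw [← Finset.sum_fiberwise_of_maps_to (s := sympBall F n d)
    (t := Finset.univ.filter (fun T : Finset (Fin n) => T.card < d)) (g := sympSupport)
    (fun v hv => by
      rw [Finset.mem_filter, card_sympSupport]; exact ⟨Finset.mem_univ _, mem_sympBall.1 hv⟩)]
  refine Finset.sum_congr rfl fun T hT => ?_
  rw [← sum_sympSupport_eq]
  refine Finset.sum_congr ?_ fun _ _ => rfl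
  ext v
  simp only [Finset.mem_filter, mem_sympBall, Finset.mem_univ, true_and] at hT ⊢
  exact ⟨fun h => h.2, fun h => ⟨by rw [← card_sympSupport, h]; exact hT, h⟩⟩

theorem card_sympBall (d : ℕ) : ((sympBall F n d).card : ℝ) =
    ∑ i ∈ Finset.range d, (n.choose i : ℝ) * ((Fintype.card F : ℝ) ^ 2 - 1) ^ i := by
  classical
  have h1 := sum_sympBall (F := F) (n := n) (R := ℝ) d (fun _ _ => 1)
  simp only [Finset.prod_const_one, Finset.sum_const, nsmul_eq_mul, mul_one] at h1
  rw [h1]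
  simp_rw [sum_ite_eq_zero, zero_add, mul_one]
  rw [← Finset.sum_fiberwise_of_maps_to (t := Finset.range d) (g := Finset.card)
    (fun T hT => by simpa using hT)]
  refine Finset.sum_congr rfl fun i hi => ?_
  have h2 : ∀ T ∈ (Finset.univ.filter (fun T : Finset (Fin n) => T.card < d)).filter
      (fun T => T.card = i), (∏ j, if j ∈ T then (Fintype.card F : ℝ) ^ 2 - 1 else 1) =
        ((Fintype.card F : ℝ) ^ 2 - 1) ^ i := by
    intro T hT
    rw [Finset.prod_ite_mem, Finset.univ_inter, Finset.prod_const, (Finset.mem_filter.1 hT).2]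
  rw [Finset.sum_congr rfl h2, Finset.sum_const, nsmul_eq_mul]
  congr 2
  have : (Finset.univ.filter (fun T : Finset (Fin n) => T.card < d)).filter
      (fun T => T.card = i) = Finset.univ.powersetCard i := by
    ext T
    simp only [Finset.mem_filter, Finset.mem_univ, true_and, Finset.mem_powersetCard,
      Finset.subset_univ]
    exact ⟨fun h => h.2, fun h => ⟨h ▸ Finset.mem_range.1 hi, h⟩⟩
  rw [this, Finset.card_powersetCard, Finset.card_univ, Fintype.card_fin]

/-- A sum over the ball is bounded by a geometrically weighted sum over the whole space. -/
theorem sum_sympBall_mul_le {d : ℕ} (hd : 1 ≤ d) {x : ℝ} (hx0 : 0 < x) (hx1 : x ≤ 1)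
    {f : (Fin n → F) × (Fin n → F) → ℝ} (hf : ∀ v, 0 ≤ f v) :
    (∑ v ∈ sympBall F n d, f v) * x ^ (d - 1) ≤ ∑ v, x ^ sympWeight v * f v := by
  rw [Finset.sum_mul]
  refine (Finset.sum_le_sum (g := fun v => x ^ sympWeight v * f v) fun v hv => ?_).trans
    (Finset.sum_le_univ_sum_of_nonneg fun v => mul_nonneg (by positivity) (hf v))
  rw [mul_comm]
  exact mul_le_mul_of_nonneg_right
    (pow_le_pow_of_le_one hx0.le hx1 (by have := mem_sympBall.1 hv; omega)) (hf v)

-- Both weights are at most `d - 1`, so the weight `s ^ (wt v + wt (v + z))` dominates the left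
-- side, and its sum factors over coordinates. The second factor, from coordinates with `z i ≠ 0`,
-- is smaller than the first by exactly `(1 - s) ^ 2`.
open scoped Classical in
theorem card_sympBall_inter_mul_le {d : ℕ} (hd : 1 ≤ d) {s : ℝ} (hs0 : 0 < s) (hs1 : s ≤ 1)
    (z : (Fin n → F) × (Fin n → F)) :
    (((sympBall F n d).filter fun v => v + z ∈ sympBall F n d).card : ℝ) * (s ^ 2) ^ (d - 1) ≤
      (1 + ((Fintype.card F : ℝ) ^ 2 - 1) * s ^ 2) ^ (n - sympWeight z) *
        (2 * s + ((Fintype.card F : ℝ) ^ 2 - 2) * s ^ 2) ^ sympWeight z := by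
  have h1 : (((sympBall F n d).filter fun v => v + z ∈ sympBall F n d).card : ℝ) *
      (s ^ 2) ^ (d - 1) ≤ ∑ v, s ^ sympWeight v * s ^ sympWeight (v + z) := by
    rw [← nsmul_eq_mul, ← Finset.sum_const]
    refine (Finset.sum_le_sum (g := fun v => s ^ sympWeight v * s ^ sympWeight (v + z))
      fun v hv => ?_).trans
      (Finset.sum_le_univ_sum_of_nonneg fun v => by positivity)
    rw [Finset.mem_filter, mem_sympBall, mem_sympBall] at hv
    rw [← pow_mul, ← pow_add]
    exact pow_le_pow_of_le_one hs0.le hs1 (by omega)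
  refine h1.trans_eq ?_
  have h2 : ∀ v : (Fin n → F) × (Fin n → F), s ^ sympWeight v * s ^ sympWeight (v + z) =
      ∏ i, (fun i (p : F × F) => (if p = 0 then 1 else s) *
        (if p + (z.1 i, z.2 i) = 0 then 1 else s)) i (v.1 i, v.2 i) := by
    intro v
    rw [pow_sympWeight, pow_sympWeight, ← Finset.prod_mul_distrib]
    rfl
  rw [Finset.sum_congr rfl fun v _ => h2 v, sum_prod_coord (fun i (p : F × F) =>
    (if p = 0 then 1 else s) * (if p + (z.1 i, z.2 i) = 0 then 1 else s)), ← prod_ite_eq_zero_pow]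
  refine Finset.prod_congr rfl fun i _ => ?_
  split_ifs with hz
  · rw [hz, ← sum_ite_eq_zero]
    refine Finset.sum_congr rfl fun p _ => ?_
    rw [add_zero]
    split_ifs <;> ring
  · have h3 : ∀ p : F × F, (if p = 0 then (1 : ℝ) else s) *
        (if p + (z.1 i, z.2 i) = 0 then 1 else s) =
        s ^ 2 + (if p = 0 then s - s ^ 2 else 0) +
          (if p = -(z.1 i, z.2 i) then s - s ^ 2 else 0) := by
      intro p
      simp only [← eq_neg_iff_add_eq_zero]
      by_cases hp : p = 0
      · have hp' : ¬ p = -(z.1 i, z.2 i) := fun h => hz (by simpa [hp] using h.symm)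
        simp only [if_pos hp, if_neg hp']
        ring
      · by_cases hp' : p = -(z.1 i, z.2 i)
        · simp only [if_neg hp, if_pos hp']
          ring
        · simp only [if_neg hp, if_neg hp']
          ring
    simp_rw [h3]
    rw [Finset.sum_add_distrib, Finset.sum_add_distrib,
      Finset.sum_ite_eq' Finset.univ (0 : F × F), Finset.sum_ite_eq' Finset.univ (-(z.1 i, z.2 i))]
    simp only [Finset.sum_const, Finset.card_univ, Fintype.card_prod, Finset.mem_univ, if_true,
      nsmul_eq_mul]
    push_cast
    ring

/-- Group the ball by support. A coordinate in the support contributes `q ^ 2 - 1` where `z`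
vanishes and `-1` elsewhere; take norms and only then relax the bound on the size of the support by
the weight `x`. -/
theorem norm_sum_addChar_sympBall_mul_le {d : ℕ} (hd : 1 ≤ d) {x : ℝ} (hx0 : 0 < x)
    (hx1 : x ≤ 1) {ψ : AddChar F ℂ} (hψ : ψ ≠ 1) (z : (Fin n → F) × (Fin n → F)) :
    ‖∑ v ∈ sympBall F n d, ψ (sympInner v z)‖ * x ^ (d - 1) ≤
      (1 + ((Fintype.card F : ℝ) ^ 2 - 1) * x) ^ (n - sympWeight z) * (1 + x) ^ sympWeight z := by
  classical
  set Q := (Fintype.card F : ℝ) ^ 2 - 1 with hQ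
  have hQ0 : 0 ≤ Q := by
    have : (1 : ℝ) ≤ Fintype.card F := by exact_mod_cast Fintype.card_pos
    rw [hQ]; nlinarith
  have h1 : ∀ v, ψ (sympInner v z) = ∏ i,
      (fun i (p : F × F) => ψ (p.1 * z.2 i - p.2 * z.1 i)) i (v.1 i, v.2 i) := by
    intro v
    rw [sympInner, dotProduct, dotProduct, ← Finset.sum_sub_distrib, AddChar.map_finset_sum]
  rw [Finset.sum_congr rfl fun v _ => h1 v,
    sum_sympBall d (fun i (p : F × F) => ψ (p.1 * z.2 i - p.2 * z.1 i))]
  set c : Fin n → ℝ := fun i => if (z.1 i, z.2 i) = 0 then Q else 1 with hc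
  have hc0 : ∀ i, 0 ≤ c i := fun i => by simp only [hc]; split_ifs <;> positivity
  have h2 : ∀ T : Finset (Fin n), ‖∏ i, if i ∈ T then
      ∑ p, (if p = 0 then 0 else (fun i (p : F × F) => ψ (p.1 * z.2 i - p.2 * z.1 i)) i p)
      else (fun i (p : F × F) => ψ (p.1 * z.2 i - p.2 * z.1 i)) i 0‖ = ∏ i ∈ T, c i := by
    intro T
    rw [norm_prod, ← Finset.univ_inter T, ← Finset.prod_ite_mem]
    refine Finset.prod_congr rfl fun i _ => ?_
    simp only [Finset.univ_inter]
    split_ifs with h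
    · have := sum_addChar_symp hψ (z.1 i, z.2 i)
      simp only at this
      rw [this]
      simp only [hc]
      split_ifs with h'
      · have e : (Fintype.card F : ℂ) ^ 2 - 1 = ((Q : ℝ) : ℂ) := by rw [hQ]; push_cast; rfl
        rw [e, Complex.norm_real, Real.norm_of_nonneg hQ0]
      · simp
    · simp
  calc _ ≤ (∑ T ∈ Finset.univ.filter (fun T : Finset (Fin n) => T.card < d), ∏ i ∈ T, c i) *
        x ^ (d - 1) := by
        gcongr
        exact (norm_sum_le _ _).trans_eq (Finset.sum_congr rfl fun T _ => h2 T)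
    _ ≤ ∑ T : Finset (Fin n), ∏ i ∈ T, x * c i := by
        rw [Finset.sum_mul]
        refine (Finset.sum_le_sum (g := fun T => ∏ i ∈ T, x * c i) fun T hT => ?_).trans
          (Finset.sum_le_univ_sum_of_nonneg fun T => Finset.prod_nonneg fun i _ =>
            mul_nonneg hx0.le (hc0 i))
        rw [Finset.prod_mul_distrib, Finset.prod_const, mul_comm]
        refine mul_le_mul_of_nonneg_right (pow_le_pow_of_le_one hx0.le hx1 ?_)
          (Finset.prod_nonneg fun i _ => hc0 i)
        have := (Finset.mem_filter.1 hT).2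
        omega
    _ = ∏ i, (1 + x * c i) := by
        rw [Finset.prod_one_add, Finset.powerset_univ]
    _ = _ := by
        rw [← prod_ite_eq_zero_pow]
        refine Finset.prod_congr rfl fun i _ => ?_
        simp only [hc]
        split_ifs <;> ring

open scoped Classical in
theorem card_light_mul_le {d : ℕ} (hd : 1 ≤ d) {x : ℝ} (hx0 : 0 < x) (hx1 : x ≤ 1) :
    ((Finset.univ.filter fun v : (Fin n → F) × (Fin n → F) => 2 * sympWeight v < d).card : ℝ) *
      x ^ (d - 1) ≤ √2 ^ d * (1 + ((Fintype.card F : ℝ) ^ 2 - 1) * (x / 2)) ^ n := by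
  have h2 : (1 : ℝ) ≤ √2 := by rw [Real.one_le_sqrt]; norm_num
  have h1 : ((Finset.univ.filter fun v : (Fin n → F) × (Fin n → F) =>
      -- For light vectors the summand is at least one, since `2 ^ wt = √2 ^ (2 * wt) ≤ √2 ^ d`.
      2 * sympWeight v < d).card : ℝ) ≤ ∑ v ∈ sympBall F n d, √2 ^ d * (1 / 2) ^ sympWeight v := by
    rw [← nsmul_one, ← Finset.sum_const]
    refine (Finset.sum_le_sum (g := fun v => √2 ^ d * (1 / 2) ^ sympWeight v)
      fun v hv => ?_).trans (Finset.sum_le_sum_of_subset_of_nonneg ?_ fun _ _ _ => by positivity)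
    · have h3 : √2 ^ (2 * sympWeight v) ≤ √2 ^ d :=
        pow_le_pow_right₀ h2 (Finset.mem_filter.1 hv).2.le
      rw [pow_mul, Real.sq_sqrt zero_le_two] at h3
      rw [one_div, inv_pow, ← div_eq_mul_inv, le_div_iff₀ (by positivity)]
      linarith
    · intro v hv
      have := (Finset.mem_filter.1 hv).2
      exact mem_sympBall.2 (by omega)
  refine (mul_le_mul_of_nonneg_right h1 (by positivity)).trans
    ((sum_sympBall_mul_le hd hx0 hx1 fun v => by positivity).trans_eq ?_)
  have h3 : ∀ v : (Fin n → F) × (Fin n → F), x ^ sympWeight v * (√2 ^ d * (1 / 2) ^ sympWeight v) =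
      √2 ^ d * ∏ i, (fun _ (p : F × F) => if p = 0 then 1 else x / 2) i (v.1 i, v.2 i) := by
    intro v
    rw [← pow_sympWeight, div_pow, div_pow]
    ring
  rw [Finset.sum_congr rfl fun v _ => h3 v, ← Finset.mul_sum,
    sum_prod_coord (fun _ (p : F × F) => if p = 0 then 1 else x / 2)]
  simp_rw [sum_ite_eq_zero]
  rw [Finset.prod_const, Finset.card_univ, Fintype.card_fin]

end Ball

/-! ### Saddle-point estimate and exponential rates. -/

/-- The binomial distribution with success probability `d / (d + m)` has its mode at `d`: ratios of
consecutive terms are at least one before `d` and at most one after it. -/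
theorem choose_mul_pow_mul_pow_le (d m i : ℕ) (hi : i ≤ d + m) :
    (d + m).choose i * (d ^ i * m ^ (d + m - i)) ≤ (d + m).choose d * (d ^ d * m ^ m) := by
  have step : ∀ i, i < d + m →
      ((d + m).choose i * (d ^ i * m ^ (d + m - i))) * ((d + m - i) * d) =
      ((d + m).choose (i + 1) * (d ^ (i + 1) * m ^ (d + m - (i + 1)))) * ((i + 1) * m) := by
    intro i hi
    have h1 := Nat.choose_succ_right_eq (d + m) i
    obtain ⟨k, hk⟩ : ∃ k, d + m = i + 1 + k := ⟨d + m - (i + 1), by omega⟩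
    rw [hk] at h1 ⊢
    rw [show i + 1 + k - i = k + 1 by omega, show i + 1 + k - (i + 1) = k by omega] at *
    calc _ = ((i + 1 + k).choose i * (k + 1)) * (d ^ (i + 1) * m ^ (k + 1)) := by ring
      _ = _ := by rw [← h1]; ring
  rcases le_total i d with h | h
  · obtain ⟨j, rfl⟩ := Nat.exists_eq_add_of_le h
    clear h hi
    induction j generalizing i with
    | zero => simp
    | succ j ih =>
      have h1 := step i (by omega)
      rw [show i + (j + 1) = i + 1 + j by omega] at *
      refine le_trans ?_ (ih (i + 1) step)
      by_contra hlt
      push Not at hlt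
      have h2 : (i + 1) * m ≤ (i + 1 + j + m - i) * (i + 1 + j) := by
        rw [show i + 1 + j + m - i = 1 + j + m by omega]
        nlinarith [Nat.zero_le (j * i), Nat.zero_le (j * j), Nat.zero_le (m * j)]
      have hpos : 0 < (i + 1 + j + m - i) * (i + 1 + j) := by
        apply Nat.mul_pos <;> omega
      have := Nat.mul_lt_mul_of_lt_of_le hlt h2 hpos
      omega
  · obtain ⟨j, rfl⟩ := Nat.exists_eq_add_of_le h
    clear h
    induction j with
    | zero => simp
    | succ j ih =>
      have h1 := step (d + j) (by omega)
      refine le_trans ?_ (ih (by omega))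
      rw [show d + (j + 1) = d + j + 1 by omega]
      by_contra hlt
      push Not at hlt
      have h2 : (d + m - (d + j)) * d ≤ (d + j + 1) * m := by
        obtain ⟨k, rfl⟩ : ∃ k, m = j + 1 + k := ⟨m - (j + 1), by omega⟩
        rw [show d + (j + 1 + k) - (d + j) = 1 + k by omega]
        nlinarith [Nat.zero_le (d * j), Nat.zero_le (j * k), Nat.zero_le (j * j)]
      have hpos : 0 < (d + j + 1) * m := by
        apply Nat.mul_pos <;> omega
      have := Nat.mul_lt_mul_of_lt_of_le hlt h2 hpos
      omega

theorem pow_le_succ_mul_choose (d m : ℕ) :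
    (d + m) ^ (d + m) ≤ (d + m + 1) * ((d + m).choose d * (d ^ d * m ^ m)) := by
  rw [add_pow]
  refine (Finset.sum_le_card_nsmul _ _ ((d + m).choose d * (d ^ d * m ^ m)) fun i hi => ?_).trans
    (by rw [Finset.card_range, smul_eq_mul])
  have := choose_mul_pow_mul_pow_le d m i (by have := Finset.mem_range.1 hi; omega)
  refine le_trans (le_of_eq ?_) this
  push_cast
  ring

section Rate

variable {F : Type*} [Field F] [Fintype F] {n : ℕ}

/-- Chernoff's bound is sharp up to `2 * (n + 1)` at the saddle point: the largest of the `n + 1`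
binomial terms is at `d`. Passing to the outermost sphere of the ball, of radius `d - 1`, costs `(m
+ 1) / m ≤ 2`. -/
theorem one_add_pow_le_card_sympBall {d : ℕ} (hd : 1 ≤ d) (hdn : d < n) {x : ℝ}
    (hx : ((Fintype.card F : ℝ) ^ 2 - 1) * x * (n - d) = d) :
    (1 + ((Fintype.card F : ℝ) ^ 2 - 1) * x) ^ n ≤
      2 * (n + 1) * ((sympBall F n d).card : ℝ) * x ^ (d - 1) := by
  obtain ⟨e, rfl⟩ : ∃ e, d = e + 1 := ⟨d - 1, by omega⟩
  obtain ⟨m, rfl⟩ : ∃ m, n = e + 1 + m := ⟨n - (e + 1), by omega⟩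
  have hm : 1 ≤ m := by omega
  set Q := (Fintype.card F : ℝ) ^ 2 - 1 with hQ
  have hQ0 : 0 < Q := by
    have : (1 : ℝ) < Fintype.card F := by exact_mod_cast (Fintype.one_lt_card : 1 < Fintype.card F)
    rw [hQ]; nlinarith
  have hm0 : (1 : ℝ) ≤ m := by exact_mod_cast hm
  have hQx : Q * x = (e + 1) / m := by
    rw [eq_div_iff (by positivity)]
    push_cast at hx
    linear_combination hx
  have hx0 : 0 < x := by
    have : 0 < Q * x := by rw [hQx]; positivity
    exact (pos_iff_pos_of_mul_pos this).1 hQ0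
  have hV : ((e + 1 + m).choose e : ℝ) * Q ^ e ≤ ((sympBall F (e + 1 + m) (e + 1)).card : ℝ) := by
    rw [card_sympBall]
    exact Finset.single_le_sum (f := fun i => ((e + 1 + m).choose i : ℝ) * Q ^ i)
      (fun i _ => by positivity) (Finset.self_mem_range_succ e)
  have h1 : (e + 1 + m) ^ (e + 1 + m) ≤
      2 * (e + 1 + m + 1) * ((e + 1 + m).choose e * ((e + 1) ^ e * m ^ (m + 1))) := by
    have h2 := pow_le_succ_mul_choose (e + 1) m
    have h3 := Nat.choose_succ_right_eq (e + 1 + m) e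
    rw [show e + 1 + m - e = m + 1 by omega] at h3
    refine h2.trans ?_
    calc (e + 1 + m + 1) * ((e + 1 + m).choose (e + 1) * ((e + 1) ^ (e + 1) * m ^ m))
        = (e + 1 + m + 1) * (((e + 1 + m).choose (e + 1) * (e + 1)) * ((e + 1) ^ e * m ^ m)) := by
          ring
      _ = (e + 1 + m + 1) * (((e + 1 + m).choose e * (m + 1)) * ((e + 1) ^ e * m ^ m)) := by
          rw [h3]
      _ ≤ (e + 1 + m + 1) * (((e + 1 + m).choose e * (2 * m)) * ((e + 1) ^ e * m ^ m)) := by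
          gcongr; omega
      _ = _ := by ring
  have h1' : ((e : ℝ) + 1 + m) ^ (e + 1 + m) ≤
      2 * (e + 1 + m + 1) * ((e + 1 + m).choose e * ((e + 1) ^ e * m ^ (m + 1))) := by
    exact_mod_cast h1
  rw [Nat.add_sub_cancel]
  calc (1 + Q * x) ^ (e + 1 + m) = ((e : ℝ) + 1 + m) ^ (e + 1 + m) / m ^ (e + 1 + m) := by
        rw [← div_pow, hQx]; congr 1; field_simp; ring
    _ ≤ (2 * (e + 1 + m + 1) * ((e + 1 + m).choose e * ((e + 1) ^ e * m ^ (m + 1)))) /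
        m ^ (e + 1 + m) := by gcongr
    _ = 2 * (e + 1 + m + 1) * (((e + 1 + m).choose e : ℝ) * Q ^ e) * x ^ e := by
        rw [mul_assoc _ _ (x ^ e), mul_assoc _ _ (x ^ e), ← mul_pow, hQx, div_pow,
          show e + 1 + m = e + (m + 1) by omega, pow_add (m : ℝ) e]
        field_simp
    _ ≤ _ := by
        push_cast
        gcongr

/-- Compares an upper generating-function bound with the saddle-point lower bound for the ball: each
of `w` coordinates gains a factor `r / y`. -/
theorem le_mul_div_pow {X K D r y : ℝ} {n w : ℕ} (hw : w ≤ n) (hy : 0 < y) (hD : 0 < D)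
    (hr : 0 ≤ r) (h1 : X * D ≤ y ^ (n - w) * r ^ w) (h2 : y ^ n ≤ K * D) :
    X ≤ K * (r / y) ^ w := by
  refine le_of_mul_le_mul_right ?_ hD
  calc X * D ≤ y ^ (n - w) * r ^ w := h1
    _ = y ^ n * (r / y) ^ w := by
        rw [div_pow, ← Nat.sub_add_cancel hw, pow_add, Nat.add_sub_cancel]
        field_simp
    _ ≤ (K * D) * (r / y) ^ w := by gcongr
    _ = _ := by ring

theorem pow_le_of_rpow_le {r ρ δ : ℝ} {n d w : ℕ} (hr0 : 0 < r) (hr1 : r ≤ 1)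
    (hd : (d : ℝ) = δ * n) (hw : d ≤ 2 * w) (hρ : r ^ (δ / 2) ≤ ρ) : r ^ w ≤ ρ ^ n := by
  calc r ^ w = r ^ (w : ℝ) := (Real.rpow_natCast r w).symm
    _ ≤ r ^ (δ / 2 * n) := by
        refine Real.rpow_le_rpow_of_exponent_ge hr0 hr1 ?_
        have : (d : ℝ) ≤ 2 * w := by exact_mod_cast hw
        linarith
    _ = (r ^ (δ / 2)) ^ n := by rw [Real.rpow_mul hr0.le, Real.rpow_natCast]
    _ ≤ ρ ^ n := by
        have := Real.rpow_nonneg hr0.le (δ / 2)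
        gcongr

open scoped Classical in
/-- Exponential pseudorandomness of the ball of radius `d = δ * n`. -/
theorem exists_sympBall_rate (F : Type*) [Field F] [Fintype F] {δ : ℝ} (hδ0 : 0 < δ)
    (hδ1 : δ < 1 - 1 / (Fintype.card F : ℝ) ^ 2) :
    ∃ ρ : ℝ, 1 / 2 ≤ ρ ∧ ρ < 1 ∧ ∀ n d : ℕ, 1 ≤ n → (d : ℝ) = δ * n →
      (∀ z : (Fin n → F) × (Fin n → F), d ≤ 2 * sympWeight z →
        (((sympBall F n d).filter fun v => v + z ∈ sympBall F n d).card : ℝ) ≤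
          2 * (n + 1) * (sympBall F n d).card * ρ ^ n) ∧
      (∀ z : (Fin n → F) × (Fin n → F), d ≤ 2 * sympWeight z → ∀ ψ : AddChar F ℂ, ψ ≠ 1 →
        ‖∑ v ∈ sympBall F n d, ψ (sympInner v z)‖ ≤
          2 * (n + 1) * (sympBall F n d).card * ρ ^ n) ∧
      ((Finset.univ.filter fun v : (Fin n → F) × (Fin n → F) => 2 * sympWeight v < d).card : ℝ) ≤
        2 * (n + 1) * (sympBall F n d).card * ρ ^ n := by
  have hq : (2 : ℝ) ≤ Fintype.card F := by
    exact_mod_cast (Fintype.one_lt_card : 1 < Fintype.card F)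
  set q := (Fintype.card F : ℝ) with hqdef
  set Q := q ^ 2 - 1 with hQ
  have hQ3 : 3 ≤ Q := by rw [hQ]; nlinarith
  have hδQ : δ * q ^ 2 < Q := by
    have h := mul_lt_mul_of_pos_right hδ1 (by positivity : (0 : ℝ) < q ^ 2)
    rw [sub_mul, one_mul, one_div, inv_mul_cancel₀ (by positivity)] at h
    exact h
  have hδlt : δ < 1 := by
    have : 0 < 1 / q ^ 2 := by positivity
    linarith
  have h1δ : 0 < 1 - δ := by linarith
  -- The saddle point of the ball of radius `δ * n`; it is below one precisely because `δ < 1 - 1 /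
  -- q ^ 2`.
  set x := δ / ((1 - δ) * Q) with hx
  have hx0 : 0 < x := by positivity
  have hx1 : x < 1 := by
    rw [hx, div_lt_one (by positivity)]
    rw [hQ] at hδQ ⊢
    nlinarith
  have hQx : Q * x = δ / (1 - δ) := by rw [hx]; field_simp
  have hy : 1 + Q * x = 1 / (1 - δ) := by rw [hQx]; field_simp; ring
  have hy0 : 0 < 1 + Q * x := by positivity
  set s := √x with hs
  have hs0 : 0 < s := Real.sqrt_pos.2 hx0
  have hs2 : s ^ 2 = x := Real.sq_sqrt hx0.le
  have hs1 : s < 1 := by nlinarith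
  set r₁ := (2 * s + (q ^ 2 - 2) * s ^ 2) / (1 + Q * x) with hr₁
  set r₂ := (1 + x) / (1 + Q * x) with hr₂
  have hr₁num : 0 < 2 * s + (q ^ 2 - 2) * s ^ 2 := by
    have : 0 < (q ^ 2 - 2) * s ^ 2 := mul_pos (by linarith) (by positivity)
    linarith
  have hr₁0 : 0 < r₁ := div_pos hr₁num hy0
  have hr₂0 : 0 < r₂ := by positivity
  have hr₁1 : r₁ < 1 := by
    rw [hr₁, div_lt_one hy0, hQ, ← hs2]
    nlinarith [mul_pos (sub_pos.2 hs1) (sub_pos.2 hs1)]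
  have hr₂1 : r₂ < 1 := by
    rw [hr₂, div_lt_one hy0]
    nlinarith
  -- Here `1 - δ / 2` is `(1 + Q * x / 2) / (1 + Q * x)`. Bernoulli gives `√2 ^ δ ≤ 1 + δ / 2`, so
  -- the product is at most `1 - δ ^ 2 / 4`.
  set r₃ := √2 ^ δ * (1 - δ / 2) with hr₃
  have hr₃0 : 0 < r₃ := mul_pos (by positivity) (by linarith)
  have hr₃1 : r₃ < 1 := by
    have h1 : √2 ^ δ ≤ 1 + δ / 2 := by
      rw [Real.sqrt_eq_rpow, ← Real.rpow_mul zero_le_two]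
      have := rpow_one_add_le_one_add_mul_self (s := 1) (by norm_num)
        (p := 1 / 2 * δ) (by positivity) (by linarith)
      norm_num at this ⊢
      linarith
    have : √2 ^ δ * (1 - δ / 2) ≤ (1 + δ / 2) * (1 - δ / 2) :=
      mul_le_mul_of_nonneg_right h1 (by linarith)
    nlinarith
  have hδ2 : 0 < δ / 2 := by positivity
  -- The entry `1 / 2` ensures `1 / q ≤ ρ`, needed later to absorb `1 / q ^ M`.
  refine ⟨max (max (r₁ ^ (δ / 2)) (r₂ ^ (δ / 2))) (max r₃ (1 / 2)), by simp, ?_, ?_⟩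
  · rw [max_lt_iff, max_lt_iff, max_lt_iff]
    exact ⟨⟨Real.rpow_lt_one hr₁0.le hr₁1 hδ2, Real.rpow_lt_one hr₂0.le hr₂1 hδ2⟩, hr₃1,
      by norm_num⟩
  set ρ := max (max (r₁ ^ (δ / 2)) (r₂ ^ (δ / 2))) (max r₃ (1 / 2)) with hρ
  have hρ1 : r₁ ^ (δ / 2) ≤ ρ := (le_max_left _ _).trans (le_max_left _ _)
  have hρ2 : r₂ ^ (δ / 2) ≤ ρ := (le_max_right _ _).trans (le_max_left _ _)
  have hρ3 : r₃ ≤ ρ := (le_max_left _ _).trans (le_max_right _ _)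
  intro n d hn hd
  have hn0 : (1 : ℝ) ≤ n := by exact_mod_cast hn
  have hd1 : 1 ≤ d := by
    have : (0 : ℝ) < d := by rw [hd]; positivity
    exact_mod_cast this
  have hdn : d < n := by
    have : (d : ℝ) < n := by rw [hd]; nlinarith
    exact_mod_cast this
  have hball := one_add_pow_le_card_sympBall (F := F) hd1 hdn (x := x) (by
    rw [hQx, hd]; field_simp)
  rw [← hqdef, ← hQ] at hball
  set K := 2 * ((n : ℝ) + 1) * (sympBall F n d).card with hK
  have hK0 : 0 ≤ K := by positivity
  have hD : 0 < x ^ (d - 1) := by positivity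
  refine ⟨fun z hz => ?_, fun z hz ψ hψ => ?_, ?_⟩
  · have h1 := card_sympBall_inter_mul_le (F := F) hd1 hs0 hs1.le z
    rw [hs2] at h1
    refine (le_mul_div_pow (sympWeight_le z) hy0 hD (hs2 ▸ hr₁num.le) h1 hball).trans ?_
    rw [← hs2]
    have := pow_le_of_rpow_le hr₁0 hr₁1.le hd hz hρ1
    rw [hr₁, ← hs2] at this
    gcongr
  · have h1 := norm_sum_addChar_sympBall_mul_le (F := F) hd1 hx0 hx1.le hψ z
    refine (le_mul_div_pow (sympWeight_le z) hy0 hD (by positivity) h1 hball).trans ?_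
    have := pow_le_of_rpow_le hr₂0 hr₂1.le hd hz hρ2
    gcongr
  · have h1 := card_light_mul_le (F := F) (n := n) hd1 hx0 hx1.le
    have h2 : √2 ^ d * (1 + Q * (x / 2)) ^ n = (r₃ * (1 + Q * x)) ^ n := by
      have h3 : √2 ^ d = (√2 ^ δ) ^ n := by
        rw [← Real.rpow_natCast (√2 ^ δ), ← Real.rpow_mul (by positivity), ← hd,
          Real.rpow_natCast]
      rw [h3, ← mul_pow, hr₃]
      congr 1
      rw [← mul_div_assoc, hy, hQx]
      field_simp
      ring
    rw [← hqdef, ← hQ, h2] at h1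
    have h4 := le_mul_div_pow (w := n) (n := n) (r := r₃ * (1 + Q * x)) le_rfl hy0 hD (by positivity)
      (h1.trans_eq (by rw [Nat.sub_self, pow_zero, one_mul])) hball
    rw [mul_div_assoc, div_self hy0.ne', mul_one] at h4
    refine h4.trans ?_
    gcongr

end Rate

/-! ### The symplectic form, and lowering the distance by transvections. -/

section Symp

variable {F : Type*} [Field F] {n : ℕ}

theorem sympInner_eq_sum (u v : (Fin n → F) × (Fin n → F)) :
    sympInner u v = ∑ i, (u.1 i * v.2 i - u.2 i * v.1 i) := by
  rw [sympInner, dotProduct, dotProduct, ← Finset.sum_sub_distrib]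

/-- The symplectic inner product as a bilinear form. -/
def sympForm (F : Type*) [Field F] (n : ℕ) :
    LinearMap.BilinForm F ((Fin n → F) × (Fin n → F)) :=
  LinearMap.mk₂ F sympInner
    (fun u u' v => by simp only [sympInner, Prod.fst_add, Prod.snd_add, add_dotProduct]; ring)
    (fun c u v => by
      simp only [sympInner, Prod.smul_fst, Prod.smul_snd, smul_dotProduct, smul_eq_mul]; ring)
    (fun u v v' => by simp only [sympInner, Prod.fst_add, Prod.snd_add, dotProduct_add]; ring)
    (fun c u v => by
      simp only [sympInner, Prod.smul_fst, Prod.smul_snd, dotProduct_smul, smul_eq_mul]; ring)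

@[simp]
theorem sympForm_apply (u v : (Fin n → F) × (Fin n → F)) :
    sympForm F n u v = sympInner u v := rfl

theorem sympForm_isAlt : (sympForm F n).IsAlt := by
  intro u
  rw [sympForm_apply, sympInner, dotProduct_comm, sub_self]

theorem sympInner_self (u : (Fin n → F) × (Fin n → F)) : sympInner u u = 0 :=
  sympForm_isAlt u

theorem sympInner_comm (u v : (Fin n → F) × (Fin n → F)) : sympInner v u = -sympInner u v := by
  rw [sympInner, sympInner, dotProduct_comm v.1, dotProduct_comm v.2]; ring

theorem eq_zero_of_forall_sympInner {u : (Fin n → F) × (Fin n → F)}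
    (h : ∀ v, sympInner u v = 0) : u = 0 := by
  classical
  refine Prod.ext (funext fun i => ?_) (funext fun i => ?_)
  · simpa [sympInner] using h (0, Pi.single i 1)
  · simpa [sympInner] using h (Pi.single i 1, 0)

theorem sympForm_nondegenerate : (sympForm F n).Nondegenerate :=
  ⟨fun _ h => eq_zero_of_forall_sympInner h, fun u h => eq_zero_of_forall_sympInner fun v => by
    have := h v
    rw [sympForm_apply] at this
    rw [sympInner_comm, this, neg_zero]⟩

theorem sympDual_eq_orthogonal (C : Submodule F ((Fin n → F) × (Fin n → F))) :
    sympDual C = (sympForm F n).orthogonal C := by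
  ext x
  rw [LinearMap.BilinForm.mem_orthogonal_iff]
  refine forall₂_congr fun y _ => ?_
  rw [sympForm_apply, sympInner_comm y x, neg_eq_zero]

theorem finrank_symp : finrank F ((Fin n → F) × (Fin n → F)) = 2 * n := by
  rw [Module.finrank_prod, Module.finrank_fin_fun]; ring

theorem finrank_sympDual (C : Submodule F ((Fin n → F) × (Fin n → F))) :
    finrank F (sympDual C) = 2 * n - finrank F C := by
  rw [sympDual_eq_orthogonal, LinearMap.BilinForm.finrank_orthogonal sympForm_nondegenerate,
    finrank_symp]

theorem sympDual_sympDual (C : Submodule F ((Fin n → F) × (Fin n → F))) :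
    sympDual (sympDual C) = C := by
  rw [sympDual_eq_orthogonal, sympDual_eq_orthogonal,
    LinearMap.BilinForm.orthogonal_orthogonal sympForm_nondegenerate sympForm_isAlt.isRefl]

theorem sympWeight_eq_zero {v : (Fin n → F) × (Fin n → F)} : sympWeight v = 0 ↔ v = 0 := by
  rw [← card_sympSupport, Finset.card_eq_zero, Finset.eq_empty_iff_forall_notMem]
  simp only [mem_sympSupport, not_not]
  constructor
  · intro h
    exact Prod.ext (funext fun i => congrArg Prod.fst (h i)) (funext fun i => congrArg Prod.snd (h i))
  · rintro rfl i; rfl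

theorem exists_hasSympMinDist {C : Submodule F ((Fin n → F) × (Fin n → F))} (hC : C ≠ ⊥) :
    ∃ w, HasSympMinDist C w := by
  obtain ⟨v, hv, hv0⟩ := Submodule.exists_mem_ne_zero_of_ne_bot hC
  have hne : {w : ℕ | ∃ v ∈ C, v ≠ 0 ∧ sympWeight v = w}.Nonempty := ⟨_, v, hv, hv0, rfl⟩
  exact ⟨_, Nat.sInf_mem hne, fun _ h => Nat.sInf_le h⟩

/-- A form-preserving map carries the symplectic dual to the symplectic dual. -/
theorem sympDual_map {e : ((Fin n → F) × (Fin n → F)) ≃ₗ[F] ((Fin n → F) × (Fin n → F))}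
    (he : ∀ x y, sympInner (e x) (e y) = sympInner x y)
    (C : Submodule F ((Fin n → F) × (Fin n → F))) :
    sympDual (C.map e.toLinearMap) = (sympDual C).map e.toLinearMap := by
  ext x
  obtain ⟨x, rfl⟩ := e.surjective x
  have h1 : e x ∈ (sympDual C).map e.toLinearMap ↔ x ∈ sympDual C := by
    simp
  rw [h1]
  constructor
  · intro h y hy
    rw [← he]
    exact h (e y) (Submodule.mem_map_of_mem hy)
  · rintro h _ ⟨y, hy, rfl⟩
    exact (he x y).trans (h y hy)

/-- The symplectic transvection `x ↦ x - a ⟨x, z⟩ z`. -/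
def sympTransvection (a : F) (z : (Fin n → F) × (Fin n → F)) :
    ((Fin n → F) × (Fin n → F)) →ₗ[F] ((Fin n → F) × (Fin n → F)) :=
  LinearMap.id - (a • (sympForm F n).flip z).smulRight z

theorem sympTransvection_apply (a : F) (z x : (Fin n → F) × (Fin n → F)) :
    sympTransvection a z x = x - (a * sympInner x z) • z := by
  simp [sympTransvection]

theorem sympInner_sub_smul_left (u v z : (Fin n → F) × (Fin n → F)) (c : F) :
    sympInner (u - c • z) v = sympInner u v - c * sympInner z v := by
  rw [← sympForm_apply, map_sub, map_smul]; rfl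

theorem sympInner_sub_smul_right (u v z : (Fin n → F) × (Fin n → F)) (c : F) :
    sympInner u (v - c • z) = sympInner u v - c * sympInner u z := by
  rw [← sympForm_apply, map_sub, map_smul]; rfl

theorem sympInner_sympTransvection (a : F) (z x y : (Fin n → F) × (Fin n → F)) :
    sympInner (sympTransvection a z x) (sympTransvection a z y) = sympInner x y := by
  rw [sympTransvection_apply, sympTransvection_apply, sympInner_sub_smul_left,
    sympInner_sub_smul_right, sympInner_sub_smul_right, sympInner_self, sympInner_comm y z]
  ring

/-- The symplectic transvection as a linear automorphism. -/
noncomputable def sympTransvectionEquiv (a : F) (z : (Fin n → F) × (Fin n → F)) :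
    ((Fin n → F) × (Fin n → F)) ≃ₗ[F] ((Fin n → F) × (Fin n → F)) :=
  LinearEquiv.ofInjectiveEndo (sympTransvection a z) <| by
    rw [← LinearMap.ker_eq_bot, LinearMap.ker_eq_bot']
    intro x hx
    refine eq_zero_of_forall_sympInner fun y => ?_
    rw [← sympInner_sympTransvection a z, hx]
    simp [sympInner]

theorem sympTransvectionEquiv_apply (a : F) (z x : (Fin n → F) × (Fin n → F)) :
    sympTransvectionEquiv a z x = x - (a * sympInner x z) • z := by
  rw [sympTransvectionEquiv, LinearEquiv.coe_ofInjectiveEndo, sympTransvection_apply]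

/-- A transvection supported on two coordinates lowers the weight by at most one. -/
theorem sympWeight_le_transvection {a : F} {z : (Fin n → F) × (Fin n → F)} {i j : Fin n}
    (hz : sympSupport z ⊆ {i, j}) (x : (Fin n → F) × (Fin n → F)) :
    sympWeight x ≤ sympWeight (sympTransvectionEquiv a z x) + 1 := by
  set y := sympTransvectionEquiv a z x with hy
  rw [sympTransvectionEquiv_apply] at hy
  have hxy : x = y + (a * sympInner x z) • z := by rw [hy]; abel
  have hyz : sympInner y z = sympInner x z := by
    rw [hy, sympInner_sub_smul_left, sympInner_self]; ring
  have hsub : sympSupport x ⊆ sympSupport y ∪ {i, j} := by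
    intro l hl
    by_contra hcon
    rw [Finset.mem_union, not_or] at hcon
    have h1 : l ∉ sympSupport z := fun h => hcon.2 (hz h)
    have h2 := hcon.1
    rw [mem_sympSupport, not_not] at h1 h2
    rw [mem_sympSupport] at hl
    apply hl
    rw [hxy]
    simp only [Prod.ext_iff, Prod.fst_zero, Prod.snd_zero] at h1 h2 ⊢
    simp [h1, h2]
  -- If `y` vanishes on both coordinates it is orthogonal to `z`, and then `x = y`. Otherwise
  -- adjoining `{i, j}` to the support of `y` adds at most one index.
  by_cases hd : Disjoint (sympSupport y) {i, j}
  · have h0 : sympInner y z = 0 := by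
      rw [sympInner_eq_sum]
      refine Finset.sum_eq_zero fun l _ => ?_
      by_cases hl : l ∈ sympSupport z
      · have h2 := Finset.disjoint_right.1 hd (hz hl)
        rw [mem_sympSupport, not_not, Prod.ext_iff] at h2
        simp only [Prod.fst_zero, Prod.snd_zero] at h2
        simp [h2]
      · rw [mem_sympSupport, not_not, Prod.ext_iff] at hl
        simp only [Prod.fst_zero, Prod.snd_zero] at hl
        simp [hl]
    rw [← hyz, h0, mul_zero, zero_smul, add_zero] at hxy
    rw [← hxy]; omega
  · have h1 := Finset.card_union_add_card_inter (sympSupport y) {i, j}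
    have h2 : 0 < (sympSupport y ∩ {i, j}).card :=
      Finset.card_pos.2 (Finset.nonempty_iff_ne_empty.2 fun h =>
        hd (Finset.disjoint_iff_inter_eq_empty.2 h))
    have h3 := Finset.card_le_card hsub
    have h4 := Finset.card_le_two (a := i) (b := j)
    rw [← card_sympSupport, ← card_sympSupport]
    omega

/-- A word of weight at least two is moved by a transvection supported on two coordinates to a word
of smaller weight. -/
theorem exists_transvection_sympWeight {w : (Fin n → F) × (Fin n → F)} (hw : 2 ≤ sympWeight w) :
    ∃ (a : F) (z : (Fin n → F) × (Fin n → F)) (i j : Fin n), sympSupport z ⊆ {i, j} ∧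
      sympWeight (sympTransvectionEquiv a z w) + 1 = sympWeight w := by
  classical
  rw [← card_sympSupport] at hw
  obtain ⟨i, hi, j, hj, hij⟩ := Finset.one_lt_card.1 hw
  have hi' := mem_sympSupport.1 hi
  obtain ⟨c, d, hcd⟩ : ∃ c d : F, w.1 i * d - w.2 i * c ≠ 0 := by
    by_cases h : w.1 i = 0
    · refine ⟨1, 0, ?_⟩
      have : w.2 i ≠ 0 := fun h2 => hi' (by rw [h, h2]; rfl)
      simpa using this
    · exact ⟨0, 1, by simpa using h⟩
  -- The target: erase coordinate `j` and replace coordinate `i` by a pair not orthogonal to that of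
  -- `w`. Then `w` pairs nontrivially with `w - w'`, and the transvection along `w - w'` can be
  -- scaled to send `w` to `w'`.
  set w' : (Fin n → F) × (Fin n → F) :=
    (Function.update (Function.update w.1 i c) j 0,
      Function.update (Function.update w.2 i d) j 0) with hw'
  have hwj : w'.1 j = 0 ∧ w'.2 j = 0 := by simp [hw']
  have hwi : w'.1 i = c ∧ w'.2 i = d := by simp [hw', hij]
  have hwl : ∀ l, l ≠ i → l ≠ j → w'.1 l = w.1 l ∧ w'.2 l = w.2 l := by
    intro l h1 h2; simp [hw', h1, h2]
  have hinner : sympInner w w' = w.1 i * d - w.2 i * c := by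
    rw [sympInner_eq_sum, Finset.sum_eq_single i, hwi.1, hwi.2]
    · intro l _ hli
      by_cases hlj : l = j
      · subst hlj; simp [hwj]
      · rw [(hwl l hli hlj).1, (hwl l hli hlj).2]; ring
    · simp
  have hne : sympInner w (w - w') ≠ 0 := by
    have := sympInner_sub_smul_right w w w' 1
    rw [one_smul, one_mul, sympInner_self, zero_sub, hinner] at this
    rw [this]
    exact neg_ne_zero.2 hcd
  refine ⟨(sympInner w (w - w'))⁻¹, w - w', i, j, ?_, ?_⟩
  · intro l hl
    by_contra hcon
    simp only [Finset.mem_insert, Finset.mem_singleton, not_or] at hcon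
    rw [mem_sympSupport] at hl
    apply hl
    have := hwl l hcon.1 hcon.2
    simp [this]
  · rw [sympTransvectionEquiv_apply, inv_mul_cancel₀ hne, one_smul, sub_sub_cancel]
    have : sympSupport w' = (sympSupport w).erase j := by
      ext l
      rw [Finset.mem_erase, mem_sympSupport, mem_sympSupport]
      by_cases hlj : l = j
      · subst hlj; simp [hwj]
      · by_cases hli : l = i
        · subst hli
          rw [hwi.1, hwi.2]
          refine iff_of_true ?_ ⟨hlj, hi'⟩
          intro h
          rw [Prod.ext_iff] at h
          simp only [Prod.fst_zero, Prod.snd_zero] at h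
          exact hcd (by rw [h.1, h.2]; ring)
        · rw [(hwl l hli hlj).1, (hwl l hli hlj).2]
          simp [hlj]
    rw [← card_sympSupport, this, ← card_sympSupport, Finset.card_erase_of_mem hj]
    omega

theorem exists_hasSympMinDist_pred {C : Submodule F ((Fin n → F) × (Fin n → F))} {w : ℕ}
    (hC : IsSympSelfOrthogonal C) (hw : 1 ≤ w) (hd : HasSympMinDist (sympDual C) (w + 1)) :
    ∃ C' : Submodule F ((Fin n → F) × (Fin n → F)), finrank F C' = finrank F C ∧
      IsSympSelfOrthogonal C' ∧ HasSympMinDist (sympDual C') w := by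
  obtain ⟨⟨v, hv, hv0, hvw⟩, hmin⟩ := hd
  obtain ⟨a, z, i, j, hz, hlt⟩ := exists_transvection_sympWeight (w := v) (by omega)
  set e := sympTransvectionEquiv a z with he
  have hpres : ∀ x y, sympInner (e x) (e y) = sympInner x y := fun x y => by
    have := sympInner_sympTransvection a z x y
    rwa [sympTransvection_apply, sympTransvection_apply, ← sympTransvectionEquiv_apply,
      ← sympTransvectionEquiv_apply] at this
  have hdual := sympDual_map hpres C
  refine ⟨C.map e.toLinearMap, LinearEquiv.finrank_map_eq e C, ?_, ?_⟩
  · rw [IsSympSelfOrthogonal, hdual]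
    exact Submodule.map_mono hC
  · rw [hdual]
    refine ⟨⟨e v, Submodule.mem_map_of_mem hv, by simpa using hv0, by omega⟩, ?_⟩
    rintro _ ⟨_, ⟨x, hx, rfl⟩, hx0, rfl⟩
    have h1 : w + 1 ≤ sympWeight x := hmin ⟨x, hx, by rintro rfl; simp at hx0, rfl⟩
    have h2 : sympWeight x ≤ sympWeight (e x) + 1 := sympWeight_le_transvection hz x
    change w ≤ sympWeight (e x)
    omega

/-- The minimum distance of the dual of a self-orthogonal code can be lowered to any positive
value. -/
theorem exists_hasSympMinDist_of_forall_le {C : Submodule F ((Fin n → F) × (Fin n → F))} {d : ℕ}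
    (hC : IsSympSelfOrthogonal C) (hd : 1 ≤ d) (hne : sympDual C ≠ ⊥)
    (hmin : ∀ v ∈ sympDual C, v ≠ 0 → d ≤ sympWeight v) :
    ∃ C' : Submodule F ((Fin n → F) × (Fin n → F)), finrank F C' = finrank F C ∧
      IsSympSelfOrthogonal C' ∧ HasSympMinDist (sympDual C') d := by
  obtain ⟨w, hw⟩ := exists_hasSympMinDist hne
  have hdw : d ≤ w := by
    obtain ⟨v, hv, hv0, rfl⟩ := hw.1
    exact hmin v hv hv0
  clear hmin hne
  obtain ⟨e, rfl⟩ := Nat.exists_eq_add_of_le hdw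
  clear hdw
  induction e generalizing C with
  | zero => exact ⟨C, rfl, hC, hw⟩
  | succ e ih =>
    obtain ⟨C', h1, h2, h3⟩ := exists_hasSympMinDist_pred (w := d + e) hC (by omega) hw
    obtain ⟨C'', h4, h5, h6⟩ := ih h2 h3
    exact ⟨C'', h4.trans h1, h5, h6⟩

end Symp

/-! ### Representatives of lines, and zeros counted by characters. -/

section Transversal

variable {F W : Type*} [Field F] [Fintype F] [AddCommGroup W] [Module F W]

open scoped Classical in
theorem exists_isTransversal {B : Finset W} (h0 : (0 : W) ∉ B)
    (hB : ∀ c : F, c ≠ 0 → ∀ b ∈ B, c • b ∈ B) :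
    ∃ B₀ : Finset W, IsTransversal F B B₀ ∧ ∀ P : W → Prop,
      (∀ c : F, c ≠ 0 → ∀ b, P b → P (c • b)) →
        ((B.filter P).card : ℝ) = ((Fintype.card F : ℝ) - 1) * (B₀.filter P).card := by
  have hne : ∀ b ∈ B, b ≠ 0 := fun b hb h => h0 (h ▸ hb)
  set B₀ := B.filter fun b => ∃ h : b ≠ 0, (Projectivization.mk F b h).rep = b with hB₀
  have hrep : ∀ b ∈ B, ∃ b₀ ∈ B₀, ∃ c : Fˣ, b = c • b₀ := by
    intro b hb
    obtain ⟨a, ha⟩ := Projectivization.exists_smul_eq_mk_rep F b (hne b hb)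
    refine ⟨(Projectivization.mk F b (hne b hb)).rep, ?_, a⁻¹, by rw [← ha, inv_smul_smul]⟩
    rw [hB₀, Finset.mem_filter]
    refine ⟨?_, Projectivization.rep_nonzero _, by rw [Projectivization.mk_rep]⟩
    rw [← ha]
    exact hB a a.ne_zero b hb
  have huniq : ∀ b ∈ B₀, ∀ b' ∈ B₀, ∀ c : F, b = c • b' → b = b' := by
    intro b hb b' hb' c hc
    obtain ⟨hbB, hb0, hbr⟩ := Finset.mem_filter.1 hb
    obtain ⟨hbB', hb0', hbr'⟩ := Finset.mem_filter.1 hb'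
    have : Projectivization.mk F b hb0 = Projectivization.mk F b' hb0' :=
      (Projectivization.mk_eq_mk_iff' F b b' hb0 hb0').2 ⟨c, hc.symm⟩
    rw [← hbr, this, hbr']
  refine ⟨B₀, ⟨Finset.filter_subset _ _, h0, hB, fun b hb => ?_, huniq⟩, fun P hP => ?_⟩
  · obtain ⟨b₀, h1, c, h2⟩ := hrep b hb
    exact ⟨b₀, h1, c, h2⟩
  · have hcard : ((Finset.univ : Finset Fˣ) ×ˢ (B₀.filter P)).card = (B.filter P).card := by
      refine Finset.card_bij (fun p _ => p.1 • p.2) ?_ ?_ ?_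
      · rintro ⟨c, b⟩ h
        simp only [Finset.mem_product, Finset.mem_univ, true_and, Finset.mem_filter] at h ⊢
        exact ⟨hB c c.ne_zero b (Finset.mem_filter.1 h.1).1, hP c c.ne_zero b h.2⟩
      · rintro ⟨c, b⟩ h ⟨c', b'⟩ h' heq
        simp only [Finset.mem_product, Finset.mem_univ, true_and, Finset.mem_filter] at h h' heq
        have h1 : b = ((c⁻¹ * c' : Fˣ) : F) • b' := by
          rw [← Units.smul_def, mul_smul, ← heq, inv_smul_smul]
        have h2 := huniq b h.1 b' h'.1 _ h1
        subst h2
        have h3 : (c : F) • b = (c' : F) • b := heq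
        have h4 := smul_left_injective F (hne b (Finset.mem_filter.1 h.1).1) h3
        rw [Units.ext h4]
      · intro b hb
        rw [Finset.mem_filter] at hb
        obtain ⟨b₀, h1, c, rfl⟩ := hrep b hb.1
        refine ⟨(c, b₀), ?_, rfl⟩
        simp only [Finset.mem_product, Finset.mem_univ, true_and, Finset.mem_filter]
        refine ⟨h1, ?_⟩
        have := hP ((c⁻¹ : Fˣ) : F) (c⁻¹).ne_zero _ hb.2
        rwa [← Units.smul_def, inv_smul_smul] at this
    rw [← hcard, Finset.card_product, Finset.card_univ, Fintype.card_units, Nat.cast_mul,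
      Nat.cast_sub Fintype.card_pos, Nat.cast_one]

end Transversal

open scoped Classical in
/-- Bound for the number of zeros of a function into a finite field by character sums. -/
theorem abs_card_filter_eq_zero_sub_le {F α : Type*} [Field F] [Fintype F] (P : Finset α)
    (φ : α → F) {K : ℝ} (hK : ∀ ψ : AddChar F ℂ, ψ ≠ 1 → ‖∑ p ∈ P, ψ (φ p)‖ ≤ K) :
    |(Fintype.card F : ℝ) * ((P.filter fun p => φ p = 0).card : ℝ) - P.card| ≤
      ((Fintype.card F : ℝ) - 1) * K := by
  obtain ⟨ψ, hψ1⟩ := AddChar.exists_apply_ne_zero.2 (one_ne_zero (α := F))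
  have hψ : ψ ≠ 1 := by
    rintro rfl
    exact hψ1 rfl
  have hp := AddChar.IsPrimitive.of_ne_one hψ
  have h1 : ∑ t : F, ∑ p ∈ P, ψ (t * φ p) =
      (Fintype.card F : ℂ) * ((P.filter fun p => φ p = 0).card : ℂ) := by
    rw [Finset.sum_comm]
    simp_rw [AddChar.sum_mulShift _ hp]
    push_cast
    rw [← Finset.sum_filter, Finset.sum_const, nsmul_eq_mul, mul_comm]
  rw [← Finset.add_sum_erase _ _ (Finset.mem_univ (0 : F))] at h1
  simp only [zero_mul, AddChar.map_zero_eq_one, Finset.sum_const, nsmul_eq_mul, mul_one] at h1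
  have h2 : ‖∑ t ∈ Finset.univ.erase (0 : F), ∑ p ∈ P, ψ (t * φ p)‖ ≤
      ((Fintype.card F : ℝ) - 1) * K := by
    refine (norm_sum_le_of_le _ (f := fun t => ∑ p ∈ P, ψ (t * φ p)) (n := fun _ => K)
      fun t ht => ?_).trans_eq ?_
    · exact hK (ψ.mulShift t) (hp (Finset.ne_of_mem_erase ht))
    · rw [Finset.sum_const, nsmul_eq_mul, Finset.card_erase_of_mem (Finset.mem_univ _),
        Finset.card_univ, Nat.cast_sub Fintype.card_pos, Nat.cast_one]
  have h3 : ∑ t ∈ Finset.univ.erase (0 : F), ∑ p ∈ P, ψ (t * φ p) =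
      (((Fintype.card F : ℝ) * ((P.filter fun p => φ p = 0).card : ℝ) - P.card : ℝ) : ℂ) := by
    push_cast
    linear_combination h1
  rwa [h3, Complex.norm_real, Real.norm_eq_abs] at h2

/-! ### From Lagrangians of the extended space to codes. -/

section Extended

variable {F : Type*} [Field F] {n r : ℕ}

/-- The orthogonal sum of two standard symplectic forms. -/
def sympFormSum (F : Type*) [Field F] (n r : ℕ) : LinearMap.BilinForm F
    (((Fin n → F) × (Fin n → F)) × ((Fin r → F) × (Fin r → F))) :=
  (sympForm F n).compl₁₂ (LinearMap.fst F _ _) (LinearMap.fst F _ _) +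
    (sympForm F r).compl₁₂ (LinearMap.snd F _ _) (LinearMap.snd F _ _)

theorem sympFormSum_apply
    (x y : ((Fin n → F) × (Fin n → F)) × ((Fin r → F) × (Fin r → F))) :
    sympFormSum F n r x y = sympInner x.1 y.1 + sympInner x.2 y.2 := rfl

theorem sympFormSum_isAlt : (sympFormSum F n r).IsAlt := fun x => by
  rw [sympFormSum_apply, sympInner_self, sympInner_self, add_zero]

theorem sympFormSum_nondegenerate : (sympFormSum F n r).Nondegenerate := by
  have h : ∀ x, (∀ y, sympFormSum F n r x y = 0) → x = 0 := by
    intro x hx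
    refine Prod.ext (eq_zero_of_forall_sympInner fun v => ?_)
      (eq_zero_of_forall_sympInner fun v => ?_)
    · simpa [sympFormSum_apply, sympInner] using hx (v, 0)
    · simpa [sympFormSum_apply, sympInner] using hx (0, v)
  exact ⟨h, fun x hx => h x fun y => sympFormSum_isAlt.isRefl _ _ (hx y)⟩

theorem finrank_sympSum :
    finrank F (((Fin n → F) × (Fin n → F)) × ((Fin r → F) × (Fin r → F))) = 2 * (n + r) := by
  rw [Module.finrank_prod, finrank_symp, finrank_symp]; ring

/-- A Lagrangian subspace of the extended space avoiding the vectors of small weight projects onto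
the symplectic dual of a self-orthogonal code. -/
theorem exists_sympSelfOrthogonal_of_lagrangian {d : ℕ} (hd : 1 ≤ d) (hr : r ≤ n)
    {L : Submodule F (((Fin n → F) × (Fin n → F)) × ((Fin r → F) × (Fin r → F)))}
    (hL : L ≤ (sympFormSum F n r).orthogonal L) (hfr : finrank F L = n + r)
    (hmin : ∀ x ∈ L, x ≠ 0 → d ≤ sympWeight x.1) :
    ∃ C : Submodule F ((Fin n → F) × (Fin n → F)), finrank F C = n - r ∧
      IsSympSelfOrthogonal C ∧ ∀ v ∈ sympDual C, v ≠ 0 → d ≤ sympWeight v := by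
  set D := L.map (LinearMap.fst F _ _) with hD
  have hinj : ∀ x ∈ L, x.1 = 0 → x = 0 := by
    intro x hx h
    by_contra h0
    have := hmin x hx h0
    rw [h, sympWeight_eq_zero.2 rfl] at this
    omega
  have hDr : finrank F D = n + r := by
    have hrange : D = LinearMap.range ((LinearMap.fst F _ _).comp L.subtype) := by
      rw [LinearMap.range_comp, Submodule.range_subtype]
    rw [hrange, LinearMap.finrank_range_of_inj, hfr]
    rintro ⟨x, hx⟩ ⟨y, hy⟩ hxy
    have := hinj (x - y) (L.sub_mem hx hy) (sub_eq_zero.2 hxy)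
    exact Subtype.ext (sub_eq_zero.1 this)
  have hLL : (sympFormSum F n r).orthogonal L = L := by
    refine (Submodule.eq_of_le_of_finrank_eq hL ?_).symm
    rw [LinearMap.BilinForm.finrank_orthogonal sympFormSum_nondegenerate, finrank_sympSum, hfr]
    omega
  refine ⟨sympDual D, by rw [finrank_sympDual, hDr]; omega, ?_, ?_⟩
  · rw [IsSympSelfOrthogonal, sympDual_sympDual]
    intro z hz
    -- Since `L` is its own orthogonal, a vector `z` orthogonal to the projection of `L` lifts to
    -- `(z, 0)` in `L`; so the dual of the projection lies in the projection.
    have : (z, 0) ∈ L := by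
      rw [← hLL]
      intro x hx
      have h1 : sympInner z x.1 = 0 := hz x.1 ⟨x, hx, rfl⟩
      change sympFormSum F n r x (z, 0) = 0
      rw [sympFormSum_apply, sympInner_comm z x.1, h1]
      simp [sympInner]
    exact ⟨_, this, rfl⟩
  · rw [sympDual_sympDual]
    rintro _ ⟨x, hx, rfl⟩ hx0
    exact hmin x hx (by rintro rfl; exact hx0 rfl)

end Extended

section Code

open scoped Classical in
set_option maxHeartbeats 800000 in
theorem exists_code_of_sympBall_bounds {F : Type*} [Field F] [Fintype F] {n r d T : ℕ} {K : ℝ}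
    (hd : 1 ≤ d) (hr : r ≤ n) (hK : 1 ≤ K)
    (hinter : ∀ z : (Fin n → F) × (Fin n → F), d ≤ 2 * sympWeight z →
      (((sympBall F n d).filter fun v => v + z ∈ sympBall F n d).card : ℝ) ≤ K)
    (hchar : ∀ z : (Fin n → F) × (Fin n → F), d ≤ 2 * sympWeight z → ∀ ψ : AddChar F ℂ, ψ ≠ 1 →
      ‖∑ v ∈ sympBall F n d, ψ (sympInner v z)‖ ≤ K)
    (hlight : ((Finset.univ.filter fun v : (Fin n → F) × (Fin n → F) =>
      2 * sympWeight v < d).card : ℝ) ≤ K)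
    (hV : (2 : ℝ) ≤ (sympBall F n d).card) (hT : Odd T) (hTn : 2 * T ≤ n + r)
    (hl : 20 * ((sympBall F n d).card * (Fintype.card F : ℝ) ^ (2 * r)) ≤
      (T + 1) * (((Fintype.card F : ℝ) - 1) * (Fintype.card F : ℝ) ^ (n + r)))
    (hε : 16 * (T + 1) * (4 * (Fintype.card F : ℝ) ^ (4 * T) *
      (4 * ((Fintype.card F : ℝ) - 1) * K / (sympBall F n d).card) +
      (Fintype.card F : ℝ) ^ (2 * T) / (Fintype.card F : ℝ) ^ (n + r)) * Real.exp (T + 1) ≤ 1) :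
    ∃ C : Submodule F ((Fin n → F) × (Fin n → F)), finrank F C = n - r ∧
      IsSympSelfOrthogonal C ∧ ∀ v ∈ sympDual C, v ≠ 0 → d ≤ sympWeight v := by
  have hq1 : (1 : ℝ) < Fintype.card F := by
    exact_mod_cast (Fintype.one_lt_card : 1 < Fintype.card F)
  set q := (Fintype.card F : ℝ) with hq
  set V := ((sympBall F n d).card : ℝ) with hVdef
  have hR : (Fintype.card ((Fin r → F) × (Fin r → F)) : ℝ) = q ^ (2 * r) := by
    rw [Module.card_eq_pow_finrank (K := F), finrank_symp]; push_cast; rfl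
  set R := q ^ (2 * r) with hRdef
  have hR1 : 1 ≤ R := one_le_pow₀ hq1.le
  have hq10 : 0 < q - 1 := by linarith
  set P : Finset (((Fin n → F) × (Fin n → F)) × ((Fin r → F) × (Fin r → F))) :=
    sympBall F n d ×ˢ Finset.univ with hP
  have hPcard : (P.card : ℝ) = V * R := by
    rw [hP, Finset.card_product, Finset.card_univ, Nat.cast_mul, hR]
  have h0P : (0 : ((Fin n → F) × (Fin n → F)) × ((Fin r → F) × (Fin r → F))) ∈ P := by
    rw [hP, Finset.mem_product, mem_sympBall, Prod.fst_zero, sympWeight_eq_zero.2 rfl]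
    exact ⟨by omega, Finset.mem_univ _⟩
  set B := P.erase 0 with hB
  have hmemB : ∀ x, x ∈ B ↔ x ≠ 0 ∧ sympWeight x.1 < d := by
    intro x
    rw [hB, hP, Finset.mem_erase, Finset.mem_product, mem_sympBall]
    simp
  -- Lightness is tested on the first component alone, so `A` includes the nonzero vectors supported
  -- on the added summand, for which the ball gives no information.
  set A := ((Finset.univ.filter fun v : (Fin n → F) × (Fin n → F) =>
    2 * sympWeight v < d) ×ˢ (Finset.univ : Finset ((Fin r → F) × (Fin r → F)))).erase 0 with hA
  have hmemA : ∀ x, x ∈ A ↔ x ≠ 0 ∧ 2 * sympWeight x.1 < d := by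
    intro x
    rw [hA, Finset.mem_erase, Finset.mem_product]
    simp
  obtain ⟨B₀, hB₀, hcount⟩ := exists_isTransversal (F := F) (B := B) (fun h => ((hmemB _).1 h).1 rfl)
    (fun c hc b hb => by
      rw [hmemB] at hb ⊢
      exact ⟨smul_ne_zero hc hb.1, by rw [Prod.smul_fst, sympWeight_smul hc]; exact hb.2⟩)
  have hBcard : (B.card : ℝ) = V * R - 1 := by
    rw [hB, Finset.card_erase_of_mem h0P, Nat.cast_sub (Finset.card_pos.2 ⟨0, h0P⟩), hPcard,
      Nat.cast_one]
  have hβ : V * R - 1 = (q - 1) * B₀.card := by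
    have := hcount (fun _ => True) (fun _ _ _ _ => trivial)
    rwa [Finset.filter_true, Finset.filter_true, hBcard] at this
  set η := 4 * (q - 1) * K / V with hη
  have hV0 : 0 < V := by linarith
  have hVR : 2 ≤ V * R := by nlinarith
  -- The `4` in `η` covers `V * R - 1 ≥ V * R / 2` and `K * R + 1 ≤ 2 * K * R`. The extra `1` pays
  -- for removing zero from `P`.
  have hηβ : K * R + 1 ≤ η * B₀.card := by
    have h1 : η * B₀.card = 4 * K * (V * R - 1) / V := by
      rw [hη, hβ]; ring
    rw [h1, le_div_iff₀ hV0]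
    have h2 : K * R + 1 ≤ 2 * K * R := by nlinarith
    nlinarith [mul_le_mul_of_nonneg_right h2 hV0.le]
  have hKR : 0 ≤ K * R := by positivity
  obtain ⟨L, hL1, hL2, hL3⟩ := exists_lagrangian_disjoint (ω := sympFormSum F n r) (A := A) (B := B)
    (B₀ := B₀) (M := n + r) (η := η) (T := T) sympFormSum_isAlt sympFormSum_nondegenerate
    finrank_sympSum hB₀ (fun h => ((hmemA _).1 h).1 rfl)
    (fun c hc a ha => by
      rw [hmemA] at ha ⊢
      exact ⟨smul_ne_zero hc ha.1, by rw [Prod.smul_fst, sympWeight_smul hc]; exact ha.2⟩)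
    (fun u hu0 huA => by
      have hu : d ≤ 2 * sympWeight u.1 := by
        by_contra h
        exact huA ((hmemA u).2 ⟨hu0, by omega⟩)
      have h1 := abs_card_filter_eq_zero_sub_le P
        (fun p => sympInner p.1 u.1 + sympInner p.2 u.2) (K := K * R) (fun ψ hψ => by
          rw [hP, Finset.sum_product]
          simp_rw [AddChar.map_add_eq_mul]
          rw [← Finset.sum_mul_sum, norm_mul]
          refine mul_le_mul (hchar u.1 hu ψ hψ) ?_ (norm_nonneg _) (by linarith)
          refine (norm_sum_le _ _).trans_eq ?_
          simp_rw [AddChar.norm_apply]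
          rw [Finset.sum_const, nsmul_eq_mul, mul_one, Finset.card_univ, hR])
      have h2 := hcount (fun b => sympFormSum F n r u b = 0) (fun c hc b hb => by
        rw [map_smul, hb, smul_zero])
      have h3 : ((P.filter fun p => sympInner p.1 u.1 + sympInner p.2 u.2 = 0).card : ℝ) =
          ((B.filter fun b => sympFormSum F n r u b = 0).card : ℝ) + 1 := by
        have e1 : (P.filter fun p => sympInner p.1 u.1 + sympInner p.2 u.2 = 0) =
            insert 0 (B.filter fun b => sympFormSum F n r u b = 0) := by
          ext p
          have e2 : sympInner p.1 u.1 + sympInner p.2 u.2 = -(sympFormSum F n r u p) := by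
            rw [sympFormSum_apply, sympInner_comm u.1, sympInner_comm u.2]; ring
          rw [Finset.mem_insert, Finset.mem_filter, Finset.mem_filter, hB, Finset.mem_erase, e2,
            neg_eq_zero]
          by_cases hp : p = 0
          · simp [hp, h0P]
          · simp [hp]
        rw [e1, Finset.card_insert_of_notMem]
        · push_cast; rfl
        · rw [Finset.mem_filter, hmemB]
          exact fun h => h.1.1 rfl
      rw [h3, hPcard, ← hq, h2] at h1
      have h4 : q * ((q - 1) * ((B₀.filter fun b => sympFormSum F n r u b = 0).card : ℝ) + 1) -
          V * R = (q - 1) * (q * ((B₀.filter fun b => sympFormSum F n r u b = 0).card : ℝ) -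
            B₀.card + 1) := by
        linear_combination -hβ
      rw [h4, abs_mul, abs_of_pos hq10] at h1
      have h5 := le_of_mul_le_mul_left h1 hq10
      rw [abs_le] at h5 ⊢
      constructor <;> linarith [h5.1, h5.2])
    (fun u hu0 huA => by
      have hu : d ≤ 2 * sympWeight u.1 := by
        by_contra h
        exact huA ((hmemA u).2 ⟨hu0, by omega⟩)
      have h1 : (B₀.filter fun b => b + u ∈ B) ⊆
          ((sympBall F n d).filter fun v => v + u.1 ∈ sympBall F n d) ×ˢ Finset.univ := by
        intro b hb
        rw [Finset.mem_filter] at hb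
        have h2 := (hmemB _).1 (hB₀.subset hb.1)
        have h3 := (hmemB _).1 hb.2
        rw [Finset.mem_product, Finset.mem_filter, mem_sympBall, mem_sympBall]
        exact ⟨⟨h2.2, h3.2⟩, Finset.mem_univ _⟩
      have h2 : ((B₀.filter fun b => b + u ∈ B).card : ℝ) ≤ K * R := by
        refine (Nat.cast_le.2 (Finset.card_le_card h1)).trans ?_
        rw [Finset.card_product, Nat.cast_mul, Finset.card_univ, hR]
        exact mul_le_mul_of_nonneg_right (hinter u.1 hu) (by linarith)
      exact le_trans (le_of_eq (by congr!)) (h2.trans (by linarith)))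
    (by
      have h1 : (A.card : ℝ) ≤ K * R := by
        refine (Nat.cast_le.2 (Finset.card_erase_le)).trans ?_
        rw [Finset.card_product, Nat.cast_mul, Finset.card_univ, hR]
        exact mul_le_mul_of_nonneg_right hlight (by linarith)
      linarith)
    (by linarith) hT hTn
    (by
      rw [← hq]
      refine le_of_mul_le_mul_left ?_ hq10
      linarith)
    hε
  refine exists_sympSelfOrthogonal_of_lagrangian hd hr hL1 hL2 fun x hx hx0 => ?_
  by_contra h
  exact hL3 x ((hmemB x).2 ⟨hx0, by omega⟩) hx

end Code

/-! ### Asymptotics in `n` and the choice of constants. -/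

theorem exists_forall_mul_pow_le_one (C D : ℝ) {ρ : ℝ} (hC : 0 < C) (hD : 0 < D) (hρ0 : 0 < ρ)
    (hρ1 : ρ < 1) : ∃ s₀ : ℕ, ∀ s ≥ s₀, C * (D * ρ ^ s) ^ s ≤ 1 := by
  have h1 : Filter.Tendsto (fun s : ℕ => D * ρ ^ s) Filter.atTop (nhds (D * 0)) :=
    (tendsto_pow_atTop_nhds_zero_of_lt_one hρ0.le hρ1).const_mul D
  have h2 : Filter.Tendsto (fun s : ℕ => C * (1 / 2 : ℝ) ^ s) Filter.atTop (nhds (C * 0)) :=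
    (tendsto_pow_atTop_nhds_zero_of_lt_one (by norm_num) (by norm_num)).const_mul C
  rw [mul_zero] at h1 h2
  have h3 := (h1.eventually_le_const (show (0 : ℝ) < 1 / 2 by norm_num)).and
    (h2.eventually_le_const (show (0 : ℝ) < 1 by norm_num))
  obtain ⟨s₀, hs₀⟩ := Filter.eventually_atTop.1 h3
  refine ⟨s₀, fun s hs => le_trans ?_ (hs₀ s hs).2⟩
  have := (hs₀ s hs).1
  gcongr

/-- The error term of the construction is eventually at most one. -/
theorem exists_forall_error_le_one {q ρ : ℝ} (hq : 2 ≤ q) (hρ0 : 1 / 2 ≤ ρ) (hρ1 : ρ < 1) :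
    ∃ n₀ : ℕ, ∀ n ≥ n₀, 2 * (2 * n.sqrt + 1) ≤ n ∧ ∀ V : ℝ, 0 < V → ∀ M ≥ n,
      16 * (((2 * n.sqrt + 1 : ℕ) : ℝ) + 1) * (4 * q ^ (4 * (2 * n.sqrt + 1)) *
        (4 * (q - 1) * (2 * (n + 1) * V * ρ ^ n) / V) + q ^ (2 * (2 * n.sqrt + 1)) / q ^ M) *
        Real.exp (((2 * n.sqrt + 1 : ℕ) : ℝ) + 1) ≤ 1 := by
  have hρ : 0 < ρ := by linarith
  have hq0 : 0 < q := by linarith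
  obtain ⟨s₀, hs₀⟩ := exists_forall_mul_pow_le_one (1056 * q ^ 5 * Real.exp 2)
    (q ^ 8 * Real.exp 5) (by positivity) (by positivity) hρ hρ1
  -- With `T = 2 * s + 1` and `s = ⌊√n⌋`, the error is at most a constant times `(D * ρ ^ s) ^ s`;
  -- the bound `6 ≤ s` gives `2 * T ≤ n`.
  set s₁ := max s₀ 6
  refine ⟨s₁ * s₁, fun n hn => ?_⟩
  set s := n.sqrt with hs
  have hs1 : s₁ ≤ s := Nat.le_sqrt.2 hn
  have hss : s * s ≤ n := Nat.sqrt_le n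
  have hs6 : 6 ≤ s := (le_max_right _ _).trans hs1
  have hns : n + 1 ≤ (s + 1) * (s + 1) := Nat.succ_le_succ_sqrt n
  refine ⟨by nlinarith, fun V hV M hM => ?_⟩
  have hmain := hs₀ s ((le_max_left _ _).trans hs1)
  have hes : ((s : ℝ) + 1) ≤ Real.exp s := Real.add_one_le_exp _
  have hn1 : (n : ℝ) + 1 ≤ (s + 1) * (s + 1) := by exact_mod_cast hns
  have hρn : ρ ^ n ≤ ρ ^ (s * s) := pow_le_pow_of_le_one hρ.le hρ1.le hss
  have hqM : q ^ (2 * (2 * s + 1)) / q ^ M ≤ q ^ (4 * (2 * s + 1)) * ρ ^ n := by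
    have h1 : (1 : ℝ) / q ^ M ≤ ρ ^ n := by
      calc 1 / q ^ M ≤ 1 / q ^ n :=
            one_div_le_one_div_of_le (by positivity) (pow_le_pow_right₀ (by linarith) hM)
        _ = (1 / q) ^ n := by rw [one_div_pow]
        _ ≤ ρ ^ n := by
            gcongr
            exact (one_div_le_one_div_of_le (by norm_num) hq).trans hρ0
    rw [← mul_one_div]
    have h2 : q ^ (2 * (2 * s + 1)) ≤ q ^ (4 * (2 * s + 1)) :=
      pow_le_pow_right₀ (by linarith) (by omega)
    gcongr
  have e1 : 4 * (q - 1) * (2 * ((n : ℝ) + 1) * V * ρ ^ n) / V = 8 * (q - 1) * (n + 1) * ρ ^ n := by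
    field_simp
    ring
  rw [e1]
  have h3 : 4 * q ^ (4 * (2 * s + 1)) * (8 * (q - 1) * ((n : ℝ) + 1) * ρ ^ n) +
      q ^ (2 * (2 * s + 1)) / q ^ M ≤ 33 * q * (n + 1) * (q ^ (4 * (2 * s + 1)) * ρ ^ n) := by
    have h4 : 0 ≤ q ^ (4 * (2 * s + 1)) * ρ ^ n := by positivity
    have h5 : 32 * (q - 1) * ((n : ℝ) + 1) + 1 ≤ 33 * q * (n + 1) := by
      have : (0 : ℝ) ≤ n := Nat.cast_nonneg n
      nlinarith
    nlinarith [mul_le_mul_of_nonneg_right h5 h4]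
  have hq1 : 0 ≤ q - 1 := by linarith
  push_cast
  calc 16 * (2 * (s : ℝ) + 1 + 1) * (4 * q ^ (4 * (2 * s + 1)) *
        (8 * (q - 1) * ((n : ℝ) + 1) * ρ ^ n) + q ^ (2 * (2 * s + 1)) / q ^ M) *
        Real.exp (2 * (s : ℝ) + 1 + 1)
      ≤ 16 * (2 * (s : ℝ) + 1 + 1) * (33 * q * ((s + 1) * (s + 1)) *
        (q ^ (4 * (2 * s + 1)) * ρ ^ (s * s))) * Real.exp (2 * (s : ℝ) + 1 + 1) := by
        have h6 : 33 * q * ((n : ℝ) + 1) * (q ^ (4 * (2 * s + 1)) * ρ ^ n) ≤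
            33 * q * ((s + 1) * (s + 1)) * (q ^ (4 * (2 * s + 1)) * ρ ^ (s * s)) := by gcongr
        have h7 := h3.trans h6
        gcongr
    _ = 1056 * ((s + 1) * (s + 1) * (s + 1)) * (q * q ^ (4 * (2 * s + 1)) * ρ ^ (s * s)) *
        Real.exp (2 * (s : ℝ) + 1 + 1) := by ring
    _ ≤ 1056 * (Real.exp s * Real.exp s * Real.exp s) *
        (q * q ^ (4 * (2 * s + 1)) * ρ ^ (s * s)) * Real.exp (2 * (s : ℝ) + 1 + 1) := by gcongr
    _ = 1056 * q ^ 5 * Real.exp 2 * (q ^ 8 * Real.exp 5 * ρ ^ s) ^ s := by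
        have e2 : Real.exp (2 * (s : ℝ) + 1 + 1) = Real.exp s * Real.exp s * Real.exp 2 := by
          rw [← Real.exp_add, ← Real.exp_add]; congr 1; ring
        have e3 : Real.exp 5 ^ s = Real.exp s * Real.exp s * Real.exp s * Real.exp s *
            Real.exp s := by
          rw [← Real.exp_nat_mul, ← Real.exp_add, ← Real.exp_add, ← Real.exp_add, ← Real.exp_add]
          congr 1; ring
        rw [mul_pow, mul_pow, e3, e2, ← pow_mul, ← pow_mul,
          show 4 * (2 * s + 1) = 8 * s + 4 by ring, pow_add]
        ring
    _ ≤ 1 := hmain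

theorem mainTheorem4 (F : Type*) [Field F] [Fintype F] (δ : ℝ) (hδ₀ : 0 < δ)
    (hδ₁ : δ < 1 - 1 / (Fintype.card F : ℝ) ^ 2) :
    ∃ c : ℝ, 0 < c ∧
      ∀ n k d : ℕ, 1 ≤ n → k ≤ n → (d : ℝ) = δ * (n : ℝ) →
        ((Fintype.card F : ℝ) ^ (2 * n - k) - 1) / ((Fintype.card F : ℝ) - 1) <
          c * √(n : ℝ) * (Fintype.card F : ℝ) ^ (2 * n) /
            ∑ i ∈ Finset.range d, (n.choose i : ℝ) * ((Fintype.card F : ℝ) ^ 2 - 1) ^ i →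
        ∃ C : Submodule F ((Fin n → F) × (Fin n → F)),
          Module.finrank F C = k ∧ IsSympSelfOrthogonal C ∧
          Module.finrank F (sympDual C) = 2 * n - k ∧ HasSympMinDist (sympDual C) d := by
  have hq2 : (2 : ℝ) ≤ Fintype.card F := by
    exact_mod_cast (Fintype.one_lt_card : 1 < Fintype.card F)
  obtain ⟨ρ, hρ0, hρ1, hrate⟩ := exists_sympBall_rate F hδ₀ hδ₁
  obtain ⟨n₁, hn₁⟩ := exists_forall_error_le_one hq2 hρ0 hρ1
  obtain ⟨n₂, hn₂⟩ := exists_nat_gt (2 / δ)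
  set N := max n₁ n₂ + 1 with hN
  set q := (Fintype.card F : ℝ) with hq
  have hq0 : 0 < q := by linarith
  have hq1 : 0 < q - 1 := by linarith
  -- `1 / 40` combines the `20` of the Poisson comparison with the `2` lost in `q ^ (n + r) - 1 ≥ q
  -- ^ (n + r) / 2`. The other entry makes the hypothesis false for small `n`: its left side is at
  -- least one, its right side at most one.
  refine ⟨min (1 / 40) (1 / (√N * q ^ (2 * N))), by positivity, ?_⟩
  set c := min (1 / 40) (1 / (√N * q ^ (2 * N))) with hc
  have hc0 : 0 < c := by positivity
  intro n k d hn hk hd hyp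
  have hn0 : (1 : ℝ) ≤ n := by exact_mod_cast hn
  have hd0 : (0 : ℝ) < d := by rw [hd]; positivity
  have hd1 : 1 ≤ d := by exact_mod_cast hd0
  have hVsum := card_sympBall (F := F) (n := n) d
  rw [← hq] at hVsum
  rw [← hVsum] at hyp
  set V := ((sympBall F n d).card : ℝ) with hV
  have hVpos : 1 ≤ V := by
    have : (0 : (Fin n → F) × (Fin n → F)) ∈ sympBall F n d := by
      rw [mem_sympBall, sympWeight_eq_zero.2 rfl]; omega
    exact Nat.one_le_cast.2 (Finset.card_pos.2 ⟨_, this⟩)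
  have hqk : q ≤ q ^ (2 * n - k) := le_self_pow₀ (by linarith) (by omega)
  rcases le_or_gt n (max n₁ n₂) with hsmall | hlarge
  · exfalso
    have h1 : 1 ≤ (q ^ (2 * n - k) - 1) / (q - 1) := by
      rw [le_div_iff₀ hq1]; linarith
    have h2 : c * √n * q ^ (2 * n) / V ≤ 1 := by
      rw [div_le_one (by linarith)]
      have h3 : √(n : ℝ) ≤ √N := Real.sqrt_le_sqrt (by exact_mod_cast (by omega : n ≤ N))
      have h4 : q ^ (2 * n) ≤ q ^ (2 * N) := pow_le_pow_right₀ (by linarith) (by omega)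
      calc c * √n * q ^ (2 * n) = c * (√n * q ^ (2 * n)) := by ring
        _ ≤ 1 / (√N * q ^ (2 * N)) * (√N * q ^ (2 * N)) := by
            have := min_le_right (1 / 40) (1 / (√N * q ^ (2 * N)))
            gcongr
        _ = 1 := one_div_mul_cancel (by positivity)
        _ ≤ V := hVpos
    linarith
  · obtain ⟨hT, herr⟩ := hn₁ n (by omega)
    obtain ⟨ha, hb, hl⟩ := hrate n d hn hd
    rw [← hV] at ha hb hl
    have hd2 : 2 ≤ d := by
      have h1 : 2 / δ < n := hn₂.trans_le (by exact_mod_cast (by omega : n₂ ≤ n))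
      rw [div_lt_iff₀ hδ₀, mul_comm, ← hd] at h1
      exact_mod_cast h1.le
    have hV2 : 2 ≤ V := by
      rw [hVsum]
      have h1 := Finset.sum_le_sum_of_subset_of_nonneg (s := Finset.range 2) (t := Finset.range d)
        (f := fun i => (n.choose i : ℝ) * (q ^ 2 - 1) ^ i)
        (Finset.range_subset_range.2 hd2) (fun i _ _ => by
          have : 0 ≤ q ^ 2 - 1 := by nlinarith
          positivity)
      refine le_trans ?_ h1
      simp only [Finset.sum_range_succ, Finset.sum_range_zero, Nat.choose_zero_right,
        Nat.choose_one_right, pow_zero, pow_one, Nat.cast_one]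
      have h3 : 3 ≤ q ^ 2 - 1 := by nlinarith
      nlinarith [mul_le_mul hn0 h3 (by norm_num) (by linarith)]
    set r := n - k with hr
    have hnr : 2 * n - k = n + r := by omega
    have hK1 : 1 ≤ 2 * ((n : ℝ) + 1) * V * ρ ^ n := by
      refine le_trans ?_ hl
      have : (0 : (Fin n → F) × (Fin n → F)) ∈ Finset.univ.filter
          fun v : (Fin n → F) × (Fin n → F) => 2 * sympWeight v < d := by
        rw [Finset.mem_filter, sympWeight_eq_zero.2 rfl]
        exact ⟨Finset.mem_univ _, by omega⟩
      exact Nat.one_le_cast.2 (Finset.card_pos.2 ⟨_, this⟩)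
    -- The hypothesis on `n`, `k`, `d` enters here: it bounds the Poisson parameter by a multiple of
    -- `√n`, hence by `(T + 1) / 20`.
    have hcount : 20 * (V * q ^ (2 * r)) ≤
        (((2 * n.sqrt + 1 : ℕ) : ℝ) + 1) * ((q - 1) * q ^ (n + r)) := by
      rw [hnr, div_lt_div_iff₀ hq1 (by linarith)] at hyp
      have h1 : q ^ (n + r) / 2 ≤ q ^ (n + r) - 1 := by
        rw [hnr] at hqk; linarith
      have h2 : V * q ^ (n + r) ≤ 2 * c * (q - 1) * √n * q ^ (2 * n) := by
        nlinarith [mul_le_mul_of_nonneg_right h1 (by linarith : 0 ≤ V)]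
      have h3 : √(n : ℝ) ≤ n.sqrt + 1 := by
        rw [Real.sqrt_le_left (by positivity)]
        have := Nat.lt_succ_sqrt' n
        exact_mod_cast this.le
      have h4 : c ≤ 1 / 40 := min_le_left _ _
      refine le_of_mul_le_mul_right ?_ (pow_pos hq0 (n + r))
      calc 20 * (V * q ^ (2 * r)) * q ^ (n + r) = 20 * (V * q ^ (n + r)) * q ^ (2 * r) := by ring
        _ ≤ 20 * (2 * c * (q - 1) * √n * q ^ (2 * n)) * q ^ (2 * r) := by gcongr
        _ = 40 * c * √n * (q - 1) * (q ^ (n + r) * q ^ (n + r)) := by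
            rw [← pow_add, show n + r + (n + r) = 2 * n + 2 * r by ring, pow_add]; ring
        _ ≤ 40 * (1 / 40) * (n.sqrt + 1) * (q - 1) * (q ^ (n + r) * q ^ (n + r)) := by gcongr
        _ ≤ (((2 * n.sqrt + 1 : ℕ) : ℝ) + 1) * (q - 1) * (q ^ (n + r) * q ^ (n + r)) := by
            push_cast
            gcongr
            linarith [Nat.cast_nonneg (α := ℝ) n.sqrt]
        _ = _ := by ring
    obtain ⟨C, hC1, hC2, hC3⟩ := exists_code_of_sympBall_bounds (F := F) (n := n) (r := r) (d := d)
      (T := 2 * n.sqrt + 1) hd1 (by omega) hK1 ha hb hl hV2 (odd_two_mul_add_one _) (by omega)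
      hcount (herr V (by linarith) (n + r) (by omega))
    have hne : sympDual C ≠ ⊥ := by
      intro h
      have h1 := finrank_sympDual C
      rw [h, finrank_bot, hC1] at h1
      omega
    obtain ⟨C', h1, h2, h3⟩ := exists_hasSympMinDist_of_forall_le hC2 hd1 hne hC3
    have hk' : finrank F C' = k := by rw [h1, hC1]; omega
    exact ⟨C', hk', h2, by rw [finrank_sympDual, hk'], h3⟩
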